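/- \textbf{Setting.} Formulas are built from countably many variables by $\bot,\wedge,\vee,\to$ and a binary connective $\leftarrow$ (coimplication); $\top:=\bot\to\bot$, $\neg\varphi:=\varphi\to\bot$, ${\sim}\varphi:=\varphi\leftarrow\top$. A bi-Heyting algebra is a Heyting algebra with an operation $\leftarrow$ satisfying $b\le a\vee x\iff (a\leftarrow b)\le x$; $A\models\varphi$ means that $\varphi$ takes the value $1$ under every valuation in $A$. The Heyting--Brouwer calculus $\mathsf{HB}$ is the least set of formulas that contains the intuitionistic propositional calculus and the axioms $$p\to(q\vee(q\leftarrow p)),\quad (q\leftarrow p)\to{\sim}(p\to q),\quad (r\leftarrow(q\leftarrow p))\to((q\vee r)\leftarrow p),\quad \neg(q\leftarrow p)\to(p\to q),\quad \neg(p\leftarrow p)$$ and is closed under substitution, modus ponens and the rule $\varphi/\neg{\sim}\varphi$. An \emph{extension of} $\mathsf{HB}$ (intermediate HB-logic) is a consistent set of formulas that contains $\mathsf{HB}$ and is closed under these three rules. Such a set $L$ is \emph{topologically complete} if there is a class $K$ of topological spaces $X$, each of whose algebras $\mathrm{Op}(X)$ of open sets is a bi-Heyting algebra, such that $L$ is the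 set of all formulas valid in $\mathrm{Op}(X)$ for every $X\in K$; otherwise $L$ is \emph{topologically incomplete}. \textbf{The Shehtman logic.} Let $\beta_0=q\to p$, $\gamma_0=p\to q$, $\beta_1=\gamma_0\to(\beta_0\vee q)$, $\gamma_1=\beta_0\to(\gamma_0\vee p)$, and for $n\ge 0$ let $\beta_{n+2}=\gamma_{n+1}\to(\beta_{n+1}\vee\gamma_n)$, $\gamma_{n+2}=\beta_{n+1}\to(\gamma_{n+1}\vee\beta_n)$, $\alpha_n=(\beta_{n+2}\wedge\gamma_{n+2})\to(\beta_{n+1}\vee\gamma_{n+1})$, $\delta_n=\alpha_n\vee\alpha_{n+1}$, $\varkappa_n=\alpha_{n+1}\to(\alpha_n\vee\beta_{n+2})$. Let $$\mathsf{bb}_2=\big[((p\to(q\vee r))\to(q\vee r))\wedge((q\to(p\vee r))\to(p\vee r))\wedge((r\to(p\vee q))\to(p\vee q))\big]\to(p\vee q\vee r).$$ $\mathsf{Sh}$ is the least set of formulas that contains $\mathsf{HB}$ and the formulas $(\alpha_0\to\delta_1)\to\delta_0$, $\varkappa_0$ and $\mathsf{bb}_2$, and is closed under the three rules. \textbf{The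 Fine logic.} The Fine frame is the set $\{a_i,b_i,c_i,d_i: i<\omega\}$ with the partial order generated by $b_{i+1}<b_i$, $c_{i+1}<c_i$, $b_{i+2}<c_i$, $c_{i+2}<b_i$, $a_i<b_{i+1}$, $a_i<c_{i+1}$, $d_i<a_i$, $d_i<d_{i+1}$. Let $X$ be the one-point compactification of the discrete Fine frame, with point at infinity $\infty$ and with the order extended by $d_i\le\infty\le b_i,c_i$ for all $i$. The clopen upsets of $X$ form a bi-Heyting algebra $\mathfrak A$, and $\mathsf F$ is the set of all formulas $\varphi$ with $\mathfrak A\models\varphi$. \textbf{Theorem.} The set of topologically incomplete extensions of $\mathsf{HB}$ has cardinality $2^{\aleph_0}$. Moreover, the set of topologically incomplete extensions $L$ of $\mathsf{HB}$ with $\mathsf{Sh}\subseteq L\subseteq\mathsf F$ has cardinality $2^{\aleph_0}$. -/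

import Mathlib

universe u

/-! Formulas of the propositional language with coimplication. -/

/-- Formulas in the language `⊥, ∧, ∨, →, ←` over countably many variables. -/
inductive HBFormula : Type
  | var (n : ℕ) : HBFormula
  | bot : HBFormula
  | and (φ ψ : HBFormula) : HBFormula
  | or (φ ψ : HBFormula) : HBFormula
  | imp (φ ψ : HBFormula) : HBFormula
  | coimp (φ ψ : HBFormula) : HBFormula

namespace HBFormula

/-- `⊤` is `⊥ → ⊥`. -/
def top : HBFormula := imp bot bot

/-- `¬φ` is `φ → ⊥`. -/
def neg (φ : HBFormula) : HBFormula := imp φ bot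

/-- The dual negation `∼φ`. Since `φ ← ψ` is interpreted by the least `x` with `ψ ≤ φ ⊔ x`,
this is `φ ← ⊤`, interpreted by the least `x` with `φ ⊔ x = ⊤`. -/
def coneg (φ : HBFormula) : HBFormula := coimp φ top

/-- Simultaneous substitution of formulas for variables. -/
def subst (s : ℕ → HBFormula) : HBFormula → HBFormula
  | var n => s n
  | bot => bot
  | and φ ψ => and (subst s φ) (subst s ψ)
  | or φ ψ => or (subst s φ) (subst s ψ)
  | imp φ ψ => imp (subst s φ) (subst s ψ)
  | coimp φ ψ => coimp (subst s φ) (subst s ψ)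

/-- The value of a formula in a bi-Heyting algebra. Mathlib's `b \ a` is the least `x` with
`b ≤ a ⊔ x`, that is, `a ← b`. -/
def eval {A : Type*} [BiheytingAlgebra A] (v : ℕ → A) : HBFormula → A
  | var n => v n
  | bot => ⊥
  | and φ ψ => eval v φ ⊓ eval v ψ
  | or φ ψ => eval v φ ⊔ eval v ψ
  | imp φ ψ => eval v φ ⇨ eval v ψ
  | coimp φ ψ => eval v ψ \ eval v φ

/-- `A ⊨ φ`: the formula takes the value `⊤` under every valuation in `A`. -/
def ValidIn (A : Type*) [BiheytingAlgebra A] (φ : HBFormula) : Prop :=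
  ∀ v : ℕ → A, φ.eval v = ⊤

end HBFormula

open HBFormula in
/-- The intuitionistic propositional calculus (over all formulas of the language). -/
inductive IPC : HBFormula → Prop
  | k (φ ψ : HBFormula) : IPC (imp φ (imp ψ φ))
  | s (φ ψ χ : HBFormula) :
      IPC (imp (imp φ (imp ψ χ)) (imp (imp φ ψ) (imp φ χ)))
  | andLeft (φ ψ : HBFormula) : IPC (imp (and φ ψ) φ)
  | andRight (φ ψ : HBFormula) : IPC (imp (and φ ψ) ψ)
  | andIntro (φ ψ : HBFormula) : IPC (imp φ (imp ψ (and φ ψ)))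
  | orLeft (φ ψ : HBFormula) : IPC (imp φ (or φ ψ))
  | orRight (φ ψ : HBFormula) : IPC (imp ψ (or φ ψ))
  | orElim (φ ψ χ : HBFormula) :
      IPC (imp (imp φ χ) (imp (imp ψ χ) (imp (or φ ψ) χ)))
  | exFalso (φ : HBFormula) : IPC (imp bot φ)
  | mp (φ ψ : HBFormula) : IPC (imp φ ψ) → IPC φ → IPC ψ

namespace HBFormula

/-- The propositional letter `p`. -/
def p : HBFormula := var 0

/-- The propositional letter `q`. -/
def q : HBFormula := var 1

/-- The propositional letter `r`. -/
def r : HBFormula := var 2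

end HBFormula

open HBFormula in
/-- The axioms for coimplication:
`p → (q ∨ (q ← p))`, `(q ← p) → ∼(p → q)`, `(r ← (q ← p)) → ((q ∨ r) ← p)`,
`¬(q ← p) → (p → q)`, `¬(p ← p)`. -/
def HBAxioms : Set HBFormula :=
  { imp p (or q (coimp q p)),
    imp (coimp q p) (coneg (imp p q)),
    imp (coimp r (coimp q p)) (coimp (or q r) p),
    imp (neg (coimp q p)) (imp p q),
    neg (coimp p p) }

/-- Closure under substitution, modus ponens and the rule `φ / ¬∼φ`. -/
structure ClosedUnderRules (L : Set HBFormula) : Prop where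
  subst : ∀ (s : ℕ → HBFormula) (φ : HBFormula), φ ∈ L → φ.subst s ∈ L
  mp : ∀ φ ψ : HBFormula, HBFormula.imp φ ψ ∈ L → φ ∈ L → ψ ∈ L
  negConeg : ∀ φ : HBFormula, φ ∈ L → φ.coneg.neg ∈ L

/-- The Heyting-Brouwer calculus. -/
def HB : Set HBFormula :=
  ⋂₀ {L | {φ | IPC φ} ⊆ L ∧ HBAxioms ⊆ L ∧ ClosedUnderRules L}

/-- Intermediate HB-logics, i.e. the consistent extensions of `HB`. -/
structure IsIntermediateHBLogic (L : Set HBFormula) : Prop where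
  contains_HB : HB ⊆ L
  closed : ClosedUnderRules L
  consistent : HBFormula.bot ∉ L

/-- `HB + Γ`: the least set of formulas that contains `HB` and `Γ` and is closed under the
three rules. -/
def HBPlus (Γ : Set HBFormula) : Set HBFormula :=
  ⋂₀ {L | HB ⊆ L ∧ Γ ⊆ L ∧ ClosedUnderRules L}

/-! The Shehtman logic. -/

namespace HBFormula

/-- The pair of formulas `(β n, γ n)`. -/
def betaGamma : ℕ → HBFormula × HBFormula
  | 0 => (imp q p, imp p q)
  | 1 => (imp (imp p q) (or (imp q p) q), imp (imp q p) (or (imp p q) p))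
  | n + 2 =>
    (imp (betaGamma (n + 1)).2 (or (betaGamma (n + 1)).1 (betaGamma n).2),
      imp (betaGamma (n + 1)).1 (or (betaGamma (n + 1)).2 (betaGamma n).1))

def beta (n : ℕ) : HBFormula := (betaGamma n).1

def gamma (n : ℕ) : HBFormula := (betaGamma n).2

def alpha (n : ℕ) : HBFormula :=
  imp (and (beta (n + 2)) (gamma (n + 2))) (or (beta (n + 1)) (gamma (n + 1)))

def delta (n : ℕ) : HBFormula := or (alpha n) (alpha (n + 1))

def kappa (n : ℕ) : HBFormula := imp (alpha (n + 1)) (or (alpha n) (beta (n + 2)))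

/-- The Gabbay-de Jongh formula for branching at most two. -/
def bb2 : HBFormula :=
  imp
    (and
      (and (imp (imp p (or q r)) (or q r)) (imp (imp q (or p r)) (or p r)))
      (imp (imp r (or p q)) (or p q)))
    (or (or p q) r)

end HBFormula

open HBFormula in
/-- The Shehtman logic over `HB`. -/
def ShehtmanLogic : Set HBFormula :=
  HBPlus {imp (imp (alpha 0) (delta 1)) (delta 0), kappa 0, bb2}

/-! The Fine frame, its one-point compactification, and the Fine logic. -/

/-- The points of the Fine frame. -/
inductive FineFrame : Type
  | a (i : ℕ) : FineFrame
  | b (i : ℕ) : FineFrame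
  | c (i : ℕ) : FineFrame
  | d (i : ℕ) : FineFrame

namespace FineFrame

/-- The order of the Fine frame. It is generated by
`b (i+1) < b i`, `c (i+1) < c i`, `b (i+2) < c i`, `c (i+2) < b i`,
`a i < b (i+1)`, `a i < c (i+1)`, `d i < a i`, `d i < d (i+1)`. -/
def Le : FineFrame → FineFrame → Prop
  | a i, a j => i = j
  | a i, b j => j ≤ i + 1
  | a i, c j => j ≤ i + 1
  | a _, d _ => False
  | b i, b j => j ≤ i
  | b i, c j => j + 2 ≤ i
  | b _, a _ => False
  | b _, d _ => False
  | c i, c j => j ≤ i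
  | c i, b j => j + 2 ≤ i
  | c _, a _ => False
  | c _, d _ => False
  | d i, d j => i ≤ j
  | d i, a j => i ≤ j
  | d _, b _ => True
  | d _, c _ => True

instance : PartialOrder FineFrame where
  le := Le
  le_refl x := by cases x <;> simp [Le]
  le_trans x y z h₁ h₂ := by
    cases x <;> cases y <;> cases z <;> simp only [Le] at * <;> omega
  le_antisymm x y h₁ h₂ := by
    cases x <;> cases y <;> simp only [Le, a.injEq, b.injEq, c.injEq, d.injEq] at * <;> omega

/-- The Fine frame carries the discrete topology. -/
instance : TopologicalSpace FineFrame := ⊥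

instance : DiscreteTopology FineFrame := ⟨rfl⟩

end FineFrame

/-- The one-point compactification of the Fine frame. -/
def FineSpace : Type := OnePoint FineFrame

namespace FineSpace

instance : TopologicalSpace FineSpace := inferInstanceAs (TopologicalSpace (OnePoint FineFrame))

/-- The inclusion of the Fine frame. -/
def pt (x : FineFrame) : FineSpace := (x : OnePoint FineFrame)

/-- The point at infinity. -/
def infty : FineSpace := OnePoint.infty

/-- The order of the Fine frame, extended by `d i ≤ ∞`, `∞ ≤ b i`, `∞ ≤ c i`. -/
def Le : FineSpace → FineSpace → Prop
  | some x, some y => x.Le y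
  | some (.d _), none => True
  | some _, none => False
  | none, some (.b _) => True
  | none, some (.c _) => True
  | none, some _ => False
  | none, none => True

instance : PartialOrder FineSpace where
  le := Le
  le_refl x := by
    rcases x with _ | x
    · trivial
    · exact le_refl x
  le_trans x y z h₁ h₂ := by
    rcases x with _ | (_ | _ | _ | _) <;> rcases y with _ | (_ | _ | _ | _) <;>
      rcases z with _ | (_ | _ | _ | _) <;> simp only [Le, FineFrame.Le] at * <;> omega
  le_antisymm x y h₁ h₂ := by
    rcases x with _ | x <;> rcases y with _ | y
    · rfl
    · cases y <;> simp only [Le] at *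
    · cases x <;> simp only [Le] at *
    · exact congrArg some (le_antisymm (α := FineFrame) h₁ h₂)

theorem pt_le_pt (x y : FineFrame) : pt x ≤ pt y ↔ x.Le y := Iff.rfl

theorem pt_le_infty (x : FineFrame) : pt x ≤ infty ↔ ∃ i, x = .d i := by
  cases x <;> simp [LE.le, pt, infty, Le, OnePoint.some, OnePoint.infty]

theorem infty_le_pt (x : FineFrame) :
    infty ≤ pt x ↔ (∃ i, x = .b i) ∨ ∃ i, x = .c i := by
  cases x <;> simp [LE.le, pt, infty, Le, OnePoint.some, OnePoint.infty]

theorem cases_pt (x : FineSpace) : x = infty ∨ ∃ y, x = pt y := by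
  rcases x with _ | y
  · exact Or.inl rfl
  · exact Or.inr ⟨y, rfl⟩

end FineSpace

/-- The index of a point of the Fine frame. -/
def FineFrame.idx : FineFrame → ℕ
  | a i => i
  | b i => i
  | c i => i
  | d i => i

namespace FineSpace

theorem finite_iff (S : Set FineFrame) : S.Finite ↔ ∃ n, ∀ x ∈ S, x.idx ≤ n := by
  constructor
  · intro h
    obtain ⟨n, hn⟩ := (h.image FineFrame.idx).bddAbove
    exact ⟨n, fun x hx => hn ⟨x, hx, rfl⟩⟩
  · rintro ⟨n, hn⟩
    have hf := Set.finite_Iic n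
    refine (((hf.image FineFrame.a).union (hf.image FineFrame.b)).union
      ((hf.image FineFrame.c).union (hf.image FineFrame.d))).subset ?_
    intro x hx
    have h := hn x hx
    cases x <;> simpa [FineFrame.idx] using h

theorem isClopen_iff (S : Set FineSpace) :
    IsClopen S ↔ ∃ n, ∀ x : FineFrame, n < x.idx → (pt x ∈ S ↔ infty ∈ S) := by
  have key : ∀ T : Set FineSpace,
      IsOpen T ↔ (infty ∈ T → (pt ⁻¹' T)ᶜ.Finite) := by
    intro T
    rw [← isCompact_iff_finite]
    exact (OnePoint.isOpen_def (X := FineFrame) (s := T)).trans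
      (and_iff_left (isOpen_discrete _))
  rw [IsClopen, ← isOpen_compl_iff, key, key, Set.preimage_compl, compl_compl, finite_iff,
    finite_iff]
  constructor
  · rintro ⟨h₁, h₂⟩
    by_cases hS : infty ∈ S
    · obtain ⟨n, hn⟩ := h₂ hS
      refine ⟨n, fun x hx => iff_of_true ?_ hS⟩
      by_contra hxS
      exact absurd (hn x hxS) (not_le.2 hx)
    · obtain ⟨n, hn⟩ := h₁ hS
      exact ⟨n, fun x hx => iff_of_false (fun hxS => absurd (hn x hxS) (not_le.2 hx)) hS⟩
  · rintro ⟨n, hn⟩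
    refine ⟨fun hS => ⟨n, fun x hx => ?_⟩, fun hS => ⟨n, fun x hx => ?_⟩⟩
    · by_contra hlt
      exact hS ((hn x (not_le.1 hlt)).1 hx)
    · by_contra hlt
      exact hx ((hn x (not_le.1 hlt)).2 hS)

theorem isClopen_lowerClosure {S : Set FineSpace} (hS : IsClopen S) :
    IsClopen {x | ∃ y ∈ S, x ≤ y} := by
  obtain ⟨n, hn⟩ := (isClopen_iff S).1 hS
  rw [isClopen_iff]
  by_cases h : ∃ i, pt (.b i) ∈ S ∨ pt (.c i) ∈ S
  · obtain ⟨i, hi⟩ := h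
    refine ⟨i + 2, fun x hx => iff_of_true ?_ ?_⟩
    · rcases hi with hi | hi <;> refine ⟨_, hi, ?_⟩ <;> rw [pt_le_pt] <;> cases x <;>
        simp only [FineFrame.Le, FineFrame.idx] at * <;> omega
    · rcases hi with hi | hi <;> exact ⟨_, hi, by simp [infty_le_pt]⟩
  · push Not at h
    have hinf : infty ∉ S := fun hS => (h (n + 1)).1 ((hn (.b (n + 1)) (Nat.lt_succ_self n)).2 hS)
    refine ⟨n, fun x hx => iff_of_false ?_ ?_⟩
    · rintro ⟨y, hy, hxy⟩
      rcases cases_pt y with rfl | ⟨y, rfl⟩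
      · exact hinf hy
      · have hyn : y.idx ≤ n := by
          by_contra hlt
          exact hinf ((hn y (not_le.1 hlt)).1 hy)
        rw [pt_le_pt] at hxy
        cases y with
        | b i => exact (h i).1 hy
        | c i => exact (h i).2 hy
        | a i =>
          cases x <;> simp only [FineFrame.Le, FineFrame.idx] at * <;> omega
        | d i =>
          cases x <;> simp only [FineFrame.Le, FineFrame.idx] at * <;> omega
    · rintro ⟨y, hy, hxy⟩
      rcases cases_pt y with rfl | ⟨y, rfl⟩
      · exact hinf hy
      · rcases (infty_le_pt y).1 hxy with ⟨i, rfl⟩ | ⟨i, rfl⟩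
        · exact (h i).1 hy
        · exact (h i).2 hy

theorem isClopen_upperClosure {S : Set FineSpace} (hS : IsClopen S) :
    IsClopen {x | ∃ y ∈ S, y ≤ x} := by
  obtain ⟨n, hn⟩ := (isClopen_iff S).1 hS
  rw [isClopen_iff]
  by_cases h : ∃ i, pt (.d i) ∈ S
  · obtain ⟨i, hi⟩ := h
    refine ⟨i, fun x hx => iff_of_true ⟨_, hi, ?_⟩ ⟨_, hi, by simp [pt_le_infty]⟩⟩
    rw [pt_le_pt]
    cases x <;> simp only [FineFrame.Le, FineFrame.idx] at * <;> omega
  · push Not at h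
    have hinf : infty ∉ S := fun hS => h (n + 1) ((hn (.d (n + 1)) (Nat.lt_succ_self n)).2 hS)
    refine ⟨n + 1, fun x hx => iff_of_false ?_ ?_⟩
    · rintro ⟨y, hy, hyx⟩
      rcases cases_pt y with rfl | ⟨y, rfl⟩
      · exact hinf hy
      · have hyn : y.idx ≤ n := by
          by_contra hlt
          exact hinf ((hn y (not_le.1 hlt)).1 hy)
        rw [pt_le_pt] at hyx
        cases y with
        | d i => exact h i hy
        | a i =>
          cases x <;> simp only [FineFrame.Le, FineFrame.idx] at * <;> omega
        | b i =>
          cases x <;> simp only [FineFrame.Le, FineFrame.idx] at * <;> omega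
        | c i =>
          cases x <;> simp only [FineFrame.Le, FineFrame.idx] at * <;> omega
    · rintro ⟨y, hy, hyx⟩
      rcases cases_pt y with rfl | ⟨y, rfl⟩
      · exact hinf hy
      · obtain ⟨i, rfl⟩ := (pt_le_infty y).1 hyx
        exact h i hy

end FineSpace

/-- The algebra of clopen upsets of the one-point compactification of the Fine frame. -/
abbrev FineAlgebra : Type := ClopenUpperSet FineSpace

namespace FineAlgebra

/-- The implication `U → V`, the complement of the downset generated by `U \ V`. -/
def himp (U V : FineAlgebra) : FineAlgebra where
  carrier := {x | ∃ y ∈ (U : Set FineSpace) \ V, x ≤ y}ᶜ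
  isClopen' := (FineSpace.isClopen_lowerClosure (U.isClopen.diff V.isClopen)).compl
  upper' := fun _ _ hxy hx ⟨z, hz, hyz⟩ => hx ⟨z, hz, hxy.trans hyz⟩

/-- The upset generated by `V \ U`, which is the coimplication `U ← V`. -/
def sdiff (V U : FineAlgebra) : FineAlgebra where
  carrier := {x | ∃ y ∈ (V : Set FineSpace) \ U, y ≤ x}
  isClopen' := FineSpace.isClopen_upperClosure (V.isClopen.diff U.isClopen)
  upper' := fun _ _ hxy ⟨z, hz, hzx⟩ => ⟨z, hz, hzx.trans hxy⟩

instance : BiheytingAlgebra FineAlgebra where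
  __ := (inferInstance : Lattice FineAlgebra)
  __ := (inferInstance : BoundedOrder FineAlgebra)
  himp := himp
  le_himp_iff W U V := by
    constructor
    · rintro h x ⟨hW, hU⟩
      by_contra hV
      exact h hW ⟨x, ⟨hU, hV⟩, le_rfl⟩
    · rintro h x hW ⟨y, ⟨hU, hV⟩, hxy⟩
      exact hV (h ⟨W.upper hxy hW, hU⟩)
  compl U := himp U ⊥
  himp_bot _ := rfl
  sdiff := sdiff
  sdiff_le_iff V U W := by
    constructor
    · intro h x hV
      by_cases hU : x ∈ (U : Set FineSpace)
      · exact Or.inl hU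
      · exact Or.inr (h ⟨x, ⟨hV, hU⟩, le_rfl⟩)
    · rintro h x ⟨y, ⟨hV, hU⟩, hyx⟩
      exact W.upper hyx ((h hV).resolve_left hU)
  hnot U := sdiff ⊤ U
  top_sdiff _ := rfl

end FineAlgebra

/-- The Fine logic over `HB`. -/
def FineLogic : Set HBFormula := {φ | φ.ValidIn FineAlgebra}

/-! Topological completeness. -/

/-- A Heyting algebra is bi-Heyting if for all `a`, `b` there is an element `c = a ← b` such that
`b ≤ a ⊔ x` iff `c ≤ x`, for all `x`. -/
def IsBiHeyting (A : Type*) [HeytingAlgebra A] : Prop :=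
  ∀ a b : A, ∃ c : A, ∀ x : A, b ≤ a ⊔ x ↔ c ≤ x

/-- The bi-Heyting algebra given by a Heyting algebra that is bi-Heyting. -/
noncomputable abbrev IsBiHeyting.toBiheytingAlgebra {A : Type*} [HeytingAlgebra A]
    (h : IsBiHeyting A) : BiheytingAlgebra A where
  __ := (inferInstance : HeytingAlgebra A)
  sdiff b a := (h a b).choose
  sdiff_le_iff b a x := ((h a b).choose_spec x).symm
  hnot a := (h a ⊤).choose
  top_sdiff _ := rfl

/-- `Op(X) ⊨ φ`, where the algebra of open subsets of `X` is bi-Heyting. -/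
def ValidInOpens {X : Type*} [TopologicalSpace X]
    (h : IsBiHeyting (TopologicalSpace.Opens X)) (φ : HBFormula) : Prop :=
  letI := h.toBiheytingAlgebra
  φ.ValidIn (TopologicalSpace.Opens X)

/-- `L` is topologically complete if it is the set of formulas that are valid in `Op(X)` for all
`X` in some class of topological spaces `X` for which `Op(X)` is a bi-Heyting algebra. -/
def IsTopologicallyComplete (L : Set HBFormula) : Prop :=
  ∃ (K : Set TopCat.{u}) (hK : ∀ X ∈ K, IsBiHeyting (TopologicalSpace.Opens X)),
    L = {φ | ∀ (X : TopCat.{u}) (hX : X ∈ K), ValidInOpens (hK X hX) φ}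

/-! Incompleteness comes from one formula, `delta 0`. In an algebra of open sets all meets exist,
and when the algebra is also bi-Heyting, joins distribute over them. Write `α m` for the values of
the Shehtman formulas and let `g i` be the meet of the `α m` with `m` not congruent to `i` modulo 3.
The first two Shehtman axioms give `(g i ⇨ g j ⊔ g k) ≤ g j ⊔ g k` for distinct residues, so `bb2`
gives `g 0 ⊔ g 1 ⊔ g 2 = ⊤`. Each `g i` lies below `α 0` or `α 1`, hence `α 0 ⊔ α 1 = ⊤`
(`ValidatesShehtman.sup_eq_top`). A topologically complete logic containing `Sh` therefore contains
`delta 0`.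

The Fine algebra lacks such meets. There the `α n` are either all `⊤` or complements of the downsets
of `a k, a (k+1), …` (`exists_canonical`, `Canonical.a`). This yields the axioms
(`FineAlgebra.validatesShehtman`), while the root `d 0`, below every `a i`, refutes `delta 0`. So
every extension of `HB` between `Sh` and `F` is incomplete.

To get continuum many, the Fine logic is intersected with logics of fences chosen by a set `S` of
naturals. Fences have height two, so they satisfy the Shehtman axioms trivially. The formulas `apart
n` read off the distance between the two ends: exactly one fence length refutes each, and the rooted
Fine frame validates `apart (n + 1)`. Hence distinct `S` give distinct logics. The upper bound is
the countability of the set of formulas. -/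

namespace HBFormula

/-! ### Evaluation of formulas in bi-Heyting algebras -/

section Eval

variable {A : Type*} [BiheytingAlgebra A]

@[simp] theorem eval_and (v : ℕ → A) (φ ψ : HBFormula) :
    (and φ ψ).eval v = φ.eval v ⊓ ψ.eval v := rfl

@[simp] theorem eval_or (v : ℕ → A) (φ ψ : HBFormula) :
    (or φ ψ).eval v = φ.eval v ⊔ ψ.eval v := rfl

@[simp] theorem eval_imp (v : ℕ → A) (φ ψ : HBFormula) :
    (imp φ ψ).eval v = φ.eval v ⇨ ψ.eval v := rfl

@[simp] theorem eval_coimp (v : ℕ → A) (φ ψ : HBFormula) :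
    (coimp φ ψ).eval v = ψ.eval v \ φ.eval v := rfl

@[simp] theorem eval_bot (v : ℕ → A) : bot.eval v = ⊥ := rfl

@[simp] theorem eval_var (v : ℕ → A) (n : ℕ) : (var n).eval v = v n := rfl

@[simp] theorem eval_top (v : ℕ → A) : top.eval v = ⊤ := himp_self

@[simp] theorem eval_neg (v : ℕ → A) (φ : HBFormula) : (neg φ).eval v = φ.eval v ⇨ ⊥ := rfl

@[simp] theorem eval_coneg (v : ℕ → A) (φ : HBFormula) :
    (coneg φ).eval v = ⊤ \ φ.eval v := by simp [coneg]

theorem eval_subst (s : ℕ → HBFormula) (v : ℕ → A) (φ : HBFormula) :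
    (φ.subst s).eval v = φ.eval fun n => (s n).eval v := by
  induction φ <;> simp_all [subst]

end Eval

end HBFormula

/-! ### Soundness of the calculus -/

section Soundness

variable (A : Type*) [BiheytingAlgebra A]

theorem IPC.validIn {φ : HBFormula} (h : IPC φ) : φ.ValidIn A := by
  induction h with
  | mp φ ψ _ _ h₁ h₂ => intro v; simpa [h₂ v] using h₁ v
  | k φ ψ => intro v; simp
  | s φ ψ χ =>
    intro v
    simp only [HBFormula.eval_imp, himp_eq_top_iff, le_himp_iff]
    have h₁ := himp_inf_le (a := φ.eval v) (b := ψ.eval v)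
    have h₂ := himp_inf_le (a := φ.eval v) (b := ψ.eval v ⇨ χ.eval v)
    have h₃ := himp_inf_le (a := ψ.eval v) (b := χ.eval v)
    refine (le_inf ?_ ?_).trans h₃
    · exact (inf_le_inf_right _ inf_le_left).trans h₂
    · exact (inf_le_inf_right _ inf_le_right).trans h₁
  | andLeft φ ψ => intro v; simp
  | andRight φ ψ => intro v; simp
  | andIntro φ ψ => intro v; simp
  | orLeft φ ψ => intro v; simp
  | orRight φ ψ => intro v; simp
  | orElim φ ψ χ =>
    intro v
    simp only [HBFormula.eval_imp, HBFormula.eval_or, himp_eq_top_iff, le_himp_iff, inf_sup_left]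
    refine sup_le ?_ ?_
    · exact (inf_le_inf_right _ inf_le_left).trans himp_inf_le
    · exact (inf_le_inf_right _ inf_le_right).trans himp_inf_le
  | exFalso φ => intro v; simp

theorem HBAxioms_subset_validIn : HBAxioms ⊆ {φ | φ.ValidIn A} := by
  rintro φ (rfl | rfl | rfl | rfl | rfl) v <;>
    simp only [HBFormula.eval_imp, HBFormula.eval_or, HBFormula.eval_coimp, HBFormula.eval_coneg,
      HBFormula.eval_neg, himp_eq_top_iff]
  · exact le_sup_sdiff
  · rw [sdiff_le_iff]
    set a := HBFormula.p.eval v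
    set b := HBFormula.q.eval v
    calc a = a ⊓ ((a ⇨ b) ⊔ ⊤ \ (a ⇨ b)) := by
          rw [sup_sdiff_self, sup_top_eq, inf_top_eq]
      _ ≤ b ⊔ ⊤ \ (a ⇨ b) := by
          rw [inf_sup_left]
          exact sup_le_sup inf_himp_le inf_le_right
  · rw [sdiff_sdiff_left]
  · rw [le_himp_iff]
    set a := HBFormula.p.eval v
    set b := HBFormula.q.eval v
    calc (a \ b ⇨ ⊥) ⊓ a ≤ (a \ b ⇨ ⊥) ⊓ (b ⊔ a \ b) := inf_le_inf_left _ le_sup_sdiff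
      _ ≤ b := by
          rw [inf_sup_left]
          exact sup_le inf_le_right (himp_inf_le.trans bot_le)
  · simp

theorem closedUnderRules_validIn : ClosedUnderRules {φ | φ.ValidIn A} where
  subst s φ h v := by rw [HBFormula.eval_subst]; exact h _
  mp φ ψ h₁ h₂ v := by simpa [h₂ v] using h₁ v
  negConeg φ h v := by simp [h v]

theorem HB_subset_validIn : HB ⊆ {φ | φ.ValidIn A} :=
  Set.sInter_subset_of_mem
    ⟨fun _ h => h.validIn A, HBAxioms_subset_validIn A, closedUnderRules_validIn A⟩

theorem HBPlus_subset_validIn {Γ : Set HBFormula} (h : Γ ⊆ {φ | φ.ValidIn A}) :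
    HBPlus Γ ⊆ {φ | φ.ValidIn A} :=
  Set.sInter_subset_of_mem ⟨HB_subset_validIn A, h, closedUnderRules_validIn A⟩

theorem isIntermediateHBLogic_validIn [Nontrivial A] :
    IsIntermediateHBLogic {φ | φ.ValidIn A} where
  contains_HB := HB_subset_validIn A
  closed := closedUnderRules_validIn A
  consistent h := bot_ne_top (α := A) (h fun _ => ⊥)

end Soundness

theorem ClosedUnderRules.sInter {S : Set (Set HBFormula)} (h : ∀ L ∈ S, ClosedUnderRules L) :
    ClosedUnderRules (⋂₀ S) where
  subst s φ hφ L hL := (h L hL).subst s φ (hφ L hL)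
  mp φ ψ h₁ h₂ L hL := (h L hL).mp φ ψ (h₁ L hL) (h₂ L hL)
  negConeg φ hφ L hL := (h L hL).negConeg φ (hφ L hL)

theorem IsIntermediateHBLogic.sInter {S : Set (Set HBFormula)} (hS : S.Nonempty)
    (h : ∀ L ∈ S, IsIntermediateHBLogic L) : IsIntermediateHBLogic (⋂₀ S) where
  contains_HB := Set.subset_sInter fun L hL => (h L hL).contains_HB
  closed := ClosedUnderRules.sInter fun L hL => (h L hL).closed
  consistent hbot := by
    obtain ⟨L, hL⟩ := hS
    exact (h L hL).consistent (hbot L hL)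

theorem subset_HBPlus (Γ : Set HBFormula) : Γ ⊆ HBPlus Γ :=
  Set.subset_sInter fun _ hL => hL.2.1

/-! The values of the Shehtman formulas in a Heyting algebra. -/

namespace Shehtman

variable {H : Type*} [HeytingAlgebra H]

/-- The values of `β n` and `γ n`. -/
def bc (p q : H) : ℕ → H × H
  | 0 => (q ⇨ p, p ⇨ q)
  | 1 => ((p ⇨ q) ⇨ (q ⇨ p) ⊔ q, (q ⇨ p) ⇨ (p ⇨ q) ⊔ p)
  | n + 2 =>
    ((bc p q (n + 1)).2 ⇨ (bc p q (n + 1)).1 ⊔ (bc p q n).2,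
      (bc p q (n + 1)).1 ⇨ (bc p q (n + 1)).2 ⊔ (bc p q n).1)

/-- The value of `β n`. -/
def b (p q : H) (n : ℕ) : H := (bc p q n).1

/-- The value of `γ n`. -/
def c (p q : H) (n : ℕ) : H := (bc p q n).2

/-- The value of `α n`. -/
def a (p q : H) (n : ℕ) : H :=
  b p q (n + 2) ⊓ c p q (n + 2) ⇨ b p q (n + 1) ⊔ c p q (n + 1)

theorem b_zero (p q : H) : b p q 0 = q ⇨ p := rfl

theorem c_zero (p q : H) : c p q 0 = p ⇨ q := rfl

theorem b_one (p q : H) : b p q 1 = (p ⇨ q) ⇨ (q ⇨ p) ⊔ q := rfl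

theorem c_one (p q : H) : c p q 1 = (q ⇨ p) ⇨ (p ⇨ q) ⊔ p := rfl

theorem b_add_two (p q : H) (n : ℕ) :
    b p q (n + 2) = c p q (n + 1) ⇨ b p q (n + 1) ⊔ c p q n := rfl

theorem c_add_two (p q : H) (n : ℕ) :
    c p q (n + 2) = b p q (n + 1) ⇨ c p q (n + 1) ⊔ b p q n := rfl

theorem b_mono (p q : H) : Monotone (b p q) := by
  refine monotone_nat_of_le_succ fun n => ?_
  cases n with
  | zero => exact le_sup_left.trans le_himp
  | succ n => exact le_sup_left.trans le_himp

theorem b_le_a (p q : H) {m n : ℕ} (h : m ≤ n + 1) : b p q m ≤ a p q n :=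
  (b_mono p q h).trans (le_sup_left.trans le_himp)

theorem c_mono (p q : H) : Monotone (c p q) := by
  refine monotone_nat_of_le_succ fun n => ?_
  cases n with
  | zero => exact le_sup_left.trans le_himp
  | succ n => exact le_sup_left.trans le_himp

theorem c_le_a (p q : H) {m n : ℕ} (h : m ≤ n + 1) : c p q m ≤ a p q n :=
  (c_mono p q h).trans (le_sup_right.trans le_himp)

theorem a_eq_top {p q : H} (h : b p q 1 ⊔ c p q 1 = ⊤) (n : ℕ) : a p q n = ⊤ :=
  top_le_iff.1 (h ▸ sup_le (b_le_a p q (by omega)) (c_le_a p q (by omega)))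

/-- Replacing `p, q` by `β 0 ∨ q, γ 0 ∨ p` advances the whole sequence by one. Since the logic is
closed under substitution, axioms stated at index 0 thereby hold at every index. -/
theorem bc_shift (p q : H) (n : ℕ) :
    bc ((q ⇨ p) ⊔ q) ((p ⇨ q) ⊔ p) n = bc p q (n + 1) := by
  have hp : p ≤ q ⇨ p := le_himp
  have hq : q ≤ p ⇨ q := le_himp
  have h0 : bc ((q ⇨ p) ⊔ q) ((p ⇨ q) ⊔ p) 0 = bc p q 1 := by
    have h₁ : (p ⇨ (q ⇨ p) ⊔ q) = ⊤ := himp_eq_top_iff.2 (hp.trans le_sup_left)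
    have h₂ : (q ⇨ (p ⇨ q) ⊔ p) = ⊤ := himp_eq_top_iff.2 (hq.trans le_sup_left)
    simp only [bc, sup_himp_distrib, h₁, h₂, inf_top_eq]
  have h1 : bc ((q ⇨ p) ⊔ q) ((p ⇨ q) ⊔ p) 1 = bc p q 2 := by
    have hb : p ≤ (bc p q 1).1 := hp.trans (b_mono p q zero_le_one)
    have hc : q ≤ (bc p q 1).2 := hq.trans (le_sup_left.trans le_himp)
    have e₁ : (((p ⇨ q) ⊔ p) ⇨ ((q ⇨ p) ⊔ q)) = (bc p q 1).1 := congrArg Prod.fst h0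
    have e₂ : (((q ⇨ p) ⊔ q) ⇨ ((p ⇨ q) ⊔ p)) = (bc p q 1).2 := congrArg Prod.snd h0
    have f₁ : (bc p q 1).1 ⊔ ((p ⇨ q) ⊔ p) = (bc p q 1).1 ⊔ (p ⇨ q) := by
      rw [← sup_assoc, sup_eq_left.2 (hb.trans le_sup_left)]
    have f₂ : (bc p q 1).2 ⊔ ((q ⇨ p) ⊔ q) = (bc p q 1).2 ⊔ (q ⇨ p) := by
      rw [← sup_assoc, sup_eq_left.2 (hc.trans le_sup_left)]
    rw [bc, e₁, e₂, f₁, f₂]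
    rfl
  induction n using Nat.twoStepInduction with
  | zero => exact h0
  | one => exact h1
  | more n ih₁ ih₂ => rw [bc, ih₁, ih₂]; rfl

theorem b_shift (p q : H) (n : ℕ) : b ((q ⇨ p) ⊔ q) ((p ⇨ q) ⊔ p) n = b p q (n + 1) :=
  congrArg Prod.fst (bc_shift p q n)

theorem c_shift (p q : H) (n : ℕ) : c ((q ⇨ p) ⊔ q) ((p ⇨ q) ⊔ p) n = c p q (n + 1) :=
  congrArg Prod.snd (bc_shift p q n)

theorem a_shift (p q : H) (n : ℕ) : a ((q ⇨ p) ⊔ q) ((p ⇨ q) ⊔ p) n = a p q (n + 1) := by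
  simp only [a, b_shift, c_shift]

/-- A property that holds at `0` for all `p`, `q` and transfers along the shift holds at all `n`. -/
theorem shift_induction {P : H → H → ℕ → Prop} (h0 : ∀ p q, P p q 0)
    (hs : ∀ p q n, P ((q ⇨ p) ⊔ q) ((p ⇨ q) ⊔ p) n → P p q (n + 1)) (n : ℕ) :
    ∀ p q, P p q n := by
  induction n with
  | zero => exact h0
  | succ n ih => exact fun p q => hs p q n (ih _ _)

end Shehtman

namespace HBFormula

variable {A : Type*} [BiheytingAlgebra A]

theorem eval_betaGamma (v : ℕ → A) (n : ℕ) :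
    ((betaGamma n).1.eval v, (betaGamma n).2.eval v) = Shehtman.bc (v 0) (v 1) n := by
  induction n using Nat.twoStepInduction with
  | zero => rfl
  | one => rfl
  | more n ih₁ ih₂ => rw [Shehtman.bc, ← ih₁, ← ih₂]; rfl

@[simp] theorem eval_beta (v : ℕ → A) (n : ℕ) :
    (beta n).eval v = Shehtman.b (v 0) (v 1) n := congrArg Prod.fst (eval_betaGamma v n)

@[simp] theorem eval_gamma (v : ℕ → A) (n : ℕ) :
    (gamma n).eval v = Shehtman.c (v 0) (v 1) n := congrArg Prod.snd (eval_betaGamma v n)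

@[simp] theorem eval_alpha (v : ℕ → A) (n : ℕ) :
    (alpha n).eval v = Shehtman.a (v 0) (v 1) n := by
  simp [alpha, Shehtman.a]

end HBFormula

/-- Algebras that validate the axioms of the Shehtman logic. -/
structure ValidatesShehtman (A : Type*) [BiheytingAlgebra A] : Prop where
  climb : ∀ p q : A, (Shehtman.a p q 0 ⇨ Shehtman.a p q 1 ⊔ Shehtman.a p q 2) ≤
    Shehtman.a p q 0 ⊔ Shehtman.a p q 1
  kappa : ∀ p q : A, Shehtman.a p q 1 ≤ Shehtman.a p q 0 ⊔ Shehtman.b p q 2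
  branch : ∀ p q r : A, ((p ⇨ q ⊔ r) ⇨ q ⊔ r) ⊓ ((q ⇨ p ⊔ r) ⇨ p ⊔ r) ⊓
    ((r ⇨ p ⊔ q) ⇨ p ⊔ q) ≤ p ⊔ q ⊔ r

open HBFormula in
theorem validatesShehtman_iff {A : Type*} [BiheytingAlgebra A] :
    ValidatesShehtman A ↔ ShehtmanLogic ⊆ {φ | φ.ValidIn A} := by
  constructor
  · rintro ⟨h₁, h₂, h₃⟩
    refine HBPlus_subset_validIn A ?_
    rintro φ (rfl | rfl | rfl) v
    · simpa [delta] using h₁ (v 0) (v 1)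
    · simpa [HBFormula.kappa] using h₂ (v 0) (v 1)
    · simpa [bb2, HBFormula.p, HBFormula.q, HBFormula.r] using h₃ (v 0) (v 1) (v 2)
  · intro h
    have h' := (subset_HBPlus _).trans h
    refine ⟨fun p q => ?_, fun p q => ?_, fun p q r => ?_⟩
    · simpa [delta] using h' (Or.inl rfl) fun n => if n = 0 then p else q
    · simpa [HBFormula.kappa] using h' (Or.inr (Or.inl rfl)) fun n => if n = 0 then p else q
    · simpa [bb2, HBFormula.p, HBFormula.q, HBFormula.r] using
        h' (Or.inr (Or.inr rfl)) fun n => if n = 0 then p else if n = 1 then q else r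

/-! In a bi-Heyting algebra with enough meets, the Shehtman axioms make `δ 0` valid. -/

namespace ValidatesShehtman

open Shehtman

section

variable {A : Type*} [BiheytingAlgebra A] (hA : ValidatesShehtman A) (p q : A)

include hA in
theorem climb_all (n : ℕ) :
    (a p q n ⇨ a p q (n + 1) ⊔ a p q (n + 2)) ≤ a p q n ⊔ a p q (n + 1) :=
  shift_induction
    (P := fun p q n => (a p q n ⇨ a p q (n + 1) ⊔ a p q (n + 2)) ≤ a p q n ⊔ a p q (n + 1))
    hA.climb (fun p q n h => by simpa only [a_shift] using h) n p q

include hA in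
theorem kappa_all (n : ℕ) : a p q (n + 1) ≤ a p q n ⊔ b p q (n + 2) :=
  shift_induction (P := fun p q n => a p q (n + 1) ≤ a p q n ⊔ b p q (n + 2))
    hA.kappa (fun p q n h => by simpa only [a_shift, b_shift] using h) n p q

include hA in
-- By `kappa`, `α (m+1)` exceeds `α m` by at most `β (m+2)`, which lies below every later `α n`.
theorem sup_succ_le {m n : ℕ} (h : m < n) : a p q m ⊔ a p q (m + 1) ≤ a p q m ⊔ a p q n :=
  sup_le le_sup_left
    ((hA.kappa_all p q m).trans (sup_le_sup_left (b_le_a p q (by omega)) _))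

end

end ValidatesShehtman

/-- Residuation `x \ g ≤ h ↔ x ≤ g ⊔ h` makes joins distribute over existing meets. This is where
coimplication enters the incompleteness argument. -/
theorem sup_isGLB_le {A : Type*} [CoheytingAlgebra A] {s t : Set A} {x g h : A} (hg : IsGLB s g)
    (hh : IsGLB t h) (H : ∀ y ∈ s, ∀ z ∈ t, x ≤ y ⊔ z) : x ≤ g ⊔ h := by
  rw [← sdiff_le_iff', le_isGLB_iff hg]
  intro y hy
  rw [sdiff_le_iff', ← sdiff_le_iff, le_isGLB_iff hh]
  intro z hz
  exact sdiff_le_iff.2 (H y hy z hz)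

namespace ValidatesShehtman

open Shehtman

section

variable {A : Type*} [BiheytingAlgebra A] (hA : ValidatesShehtman A) (p q : A)

/-- The values of `α m` for `m` not congruent to `i` modulo `3`. -/
def residueSet (i : ℕ) : Set A := {x | ∃ m, m % 3 ≠ i ∧ x = a p q m}

variable {p q}

/-- Under the premise of `α N`, every later `α m` holds because it lies above `β (N+2)`; the earlier
ones are assumed, and `N` itself does not occur in the meet `g`. So `g` holds, hence `α N`, and the
premise is discharged since `α N` is an implication from it. -/
theorem himp_inf_le_a {i N : ℕ} {g : A} (hg : IsGLB (residueSet p q i) g) (hN : N % 3 = i) :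
    (g ⇨ a p q N) ⊓ (Finset.range N).inf (a p q) ≤ a p q N := by
  have key : (g ⇨ a p q N) ⊓ (Finset.range N).inf (a p q) ⊓
      (b p q (N + 2) ⊓ c p q (N + 2)) ≤ g := by
    rw [le_isGLB_iff hg]
    rintro _ ⟨m, hm, rfl⟩
    rcases lt_trichotomy m N with h | h | h
    · exact inf_le_left.trans (inf_le_right.trans (Finset.inf_le (Finset.mem_range.2 h)))
    · exact absurd (h ▸ hN) hm
    · exact inf_le_right.trans (inf_le_left.trans (b_le_a p q (by omega)))
  have h₁ : (g ⇨ a p q N) ⊓ (Finset.range N).inf (a p q) ⊓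
      (b p q (N + 2) ⊓ c p q (N + 2)) ≤ a p q N :=
    (le_inf (inf_le_left.trans inf_le_left) key).trans himp_inf_le
  refine le_himp_iff.2 ((le_inf h₁ inf_le_right).trans ?_)
  exact himp_inf_le

include hA in
-- Descent from `N` to `j`: each step moves `α j` to the right as an antecedent and applies the
-- first Shehtman axiom at index `j`.
theorem himp_inf_le_sup {i N : ℕ} {g : A} (hg : IsGLB (residueSet p q i) g) (hN : N % 3 = i)
    {j : ℕ} (hj : j ≤ N) :
    (g ⇨ a p q N) ⊓ (Finset.range j).inf (a p q) ≤ a p q j ⊔ a p q (j + 1) := by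
  induction hj using Nat.decreasingInduction with
  | self => exact (himp_inf_le_a hg hN).trans le_sup_left
  | of_succ j _ ih =>
    refine le_trans (le_himp_iff.2 ?_) (hA.climb_all p q j)
    refine le_trans (le_of_eq ?_) ih
    rw [Finset.range_add_one, Finset.inf_insert, inf_assoc, inf_comm (a p q j)]

include hA in
-- The assumptions `α j`, `j < M`, are removed one at a time: by the previous bound either `α j`
-- holds, or `α M` does, and the latter is below `T`.
theorem himp_le {i M N : ℕ} {g T : A} (hg : IsGLB (residueSet p q i) g) (hN : N % 3 = i)
    (hM : M ≤ N) (hT : a p q M ≤ T)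
    (h : (g ⇨ a p q N) ⊓ (Finset.range M).inf (a p q) ≤ T) : (g ⇨ a p q N) ≤ T := by
  have key : ∀ j ≤ M, (g ⇨ a p q N) ⊓ (Finset.range j).inf (a p q) ≤ T := by
    intro j hj
    induction hj using Nat.decreasingInduction with
    | self => exact h
    | of_succ j hj ih =>
      have h₁ := (hA.himp_inf_le_sup hg hN (by omega : j ≤ N)).trans (hA.sup_succ_le p q hj)
      calc (g ⇨ a p q N) ⊓ (Finset.range j).inf (a p q)
          ≤ (g ⇨ a p q N) ⊓ (Finset.range j).inf (a p q) ⊓ (a p q j ⊔ a p q M) := le_inf le_rfl h₁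
        _ ≤ T := by
          rw [inf_sup_left]
          refine sup_le (le_trans (le_of_eq ?_) ih) (inf_le_right.trans hT)
          rw [Finset.range_add_one, Finset.inf_insert, inf_assoc, inf_comm (a p q j)]
  simpa using key 0 (Nat.zero_le _)

include hA in
-- By distributivity it suffices to reach each `α m ⊔ α n` with `m` and `n` avoiding the residues
-- `j` and `k` respectively. The join `h₁ ⊔ h₂` may be weakened to any `α N` with `N` of residue
-- `i`.
theorem himp_sup_le {i j k : ℕ} {g h₁ h₂ : A} (hg : IsGLB (residueSet p q i) g)
    (hh₁ : IsGLB (residueSet p q j) h₁) (hh₂ : IsGLB (residueSet p q k) h₂)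
    (hi : i < 3) (hj : j < 3) (hk : k < 3) (hij : i ≠ j) (hik : i ≠ k) (hjk : j ≠ k) :
    (g ⇨ h₁ ⊔ h₂) ≤ h₁ ⊔ h₂ := by
  have hle : ∀ N, N % 3 = i → h₁ ⊔ h₂ ≤ a p q N := fun N hN =>
    sup_le (hh₁.1 ⟨N, by omega, rfl⟩) (hh₂.1 ⟨N, by omega, rfl⟩)
  have hlt : ∀ M n, M < n → (g ⇨ h₁ ⊔ h₂) ≤ a p q M ⊔ a p q n := by
    intro M n hMn
    -- Any index of residue `i` that is at least `M` would do.
    have hN : (3 * M + i) % 3 = i := by omega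
    refine (himp_le_himp_left (hle _ hN)).trans ?_
    refine hA.himp_le hg hN (M := M) (by omega) le_sup_left ?_
    exact (hA.himp_inf_le_sup hg hN (by omega)).trans (hA.sup_succ_le p q hMn)
  refine sup_isGLB_le hh₁ hh₂ ?_
  rintro _ ⟨m, hm, rfl⟩ _ ⟨n, hn, rfl⟩
  rcases lt_trichotomy m n with h | rfl | h
  · exact hlt m n h
  -- A common index avoids both `j` and `k`, so it has residue `i` and can itself serve as `N`.
  · have hN : m % 3 = i := by omega
    rw [sup_idem]
    exact (himp_le_himp_left (hle _ hN)).trans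
      (hA.himp_le hg hN le_rfl le_rfl (himp_inf_le_a hg hN))
  · rw [sup_comm (a p q m)]
    exact hlt n m h

include hA in
theorem sup_eq_top (hinf : ∀ s : Set A, ∃ g, IsGLB s g) (p q : A) :
    a p q 0 ⊔ a p q 1 = ⊤ := by
  choose g hg using fun i => hinf (residueSet p q i)
  have h₀ := hA.himp_sup_le (hg 0) (hg 1) (hg 2) (by omega) (by omega) (by omega) (by omega)
    (by omega) (by omega)
  have h₁ := hA.himp_sup_le (hg 1) (hg 0) (hg 2) (by omega) (by omega) (by omega) (by omega)
    (by omega) (by omega)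
  have h₂ := hA.himp_sup_le (hg 2) (hg 0) (hg 1) (by omega) (by omega) (by omega) (by omega)
    (by omega) (by omega)
  have h := hA.branch (g 0) (g 1) (g 2)
  rw [himp_eq_top_iff.2 h₀, himp_eq_top_iff.2 h₁, himp_eq_top_iff.2 h₂, top_inf_eq, top_inf_eq,
    top_le_iff] at h
  rw [eq_top_iff, ← h]
  refine sup_le (sup_le ?_ ?_) ?_
  · exact ((hg 0).1 ⟨1, by omega, rfl⟩).trans le_sup_right
  · exact ((hg 1).1 ⟨0, by omega, rfl⟩).trans le_sup_left
  · exact ((hg 2).1 ⟨0, by omega, rfl⟩).trans le_sup_left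

end

end ValidatesShehtman

open HBFormula in
theorem validInOpens_delta_zero {X : Type*} [TopologicalSpace X]
    (h : IsBiHeyting (TopologicalSpace.Opens X))
    (hSh : ∀ φ ∈ ShehtmanLogic, ValidInOpens h φ) : ValidInOpens h (delta 0) := by
  let := h.toBiheytingAlgebra
  intro v
  have hA : ValidatesShehtman (TopologicalSpace.Opens X) := validatesShehtman_iff.2 hSh
  have := hA.sup_eq_top (fun s => ⟨sInf s, isGLB_sInf s⟩) (v 0) (v 1)
  simpa [delta] using this

theorem not_isTopologicallyComplete {L : Set HBFormula} (hSh : ShehtmanLogic ⊆ L)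
    (hL : HBFormula.delta 0 ∉ L) : ¬ IsTopologicallyComplete.{u} L := by
  rintro ⟨K, hK, rfl⟩
  exact hL fun X hX => validInOpens_delta_zero (hK X hX) fun φ hφ => hSh hφ X hX

/-! ### Representations by upsets, and branching at most two -/

/-- A faithful representation of a bi-Heyting algebra by upsets of a partially ordered set. -/
structure UpsetRep (A : Type*) [BiheytingAlgebra A] (X : Type*) [PartialOrder X] where
  carrier : A → Set X
  upper : ∀ a, IsUpperSet (carrier a)
  eq_top : ∀ a, (∀ x, x ∈ carrier a) → a = ⊤
  mem_top : ∀ x, x ∈ carrier ⊤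
  mem_bot : ∀ x, x ∉ carrier ⊥
  mem_inf : ∀ a b x, x ∈ carrier (a ⊓ b) ↔ x ∈ carrier a ∧ x ∈ carrier b
  mem_sup : ∀ a b x, x ∈ carrier (a ⊔ b) ↔ x ∈ carrier a ∨ x ∈ carrier b
  mem_himp : ∀ a b x, x ∈ carrier (a ⇨ b) ↔ ∀ y, x ≤ y → y ∈ carrier a → y ∈ carrier b
  mem_sdiff : ∀ a b x, x ∈ carrier (a \ b) ↔ ∃ y, y ≤ x ∧ y ∈ carrier a ∧ y ∉ carrier b

namespace UpsetRep

variable {A : Type*} [BiheytingAlgebra A] {X : Type*} [PartialOrder X] (R : UpsetRep A X)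

theorem le_of_forall {a b : A} (h : ∀ x ∈ R.carrier a, x ∈ R.carrier b) : a ≤ b :=
  himp_eq_top_iff.1 (R.eq_top _ fun x => (R.mem_himp a b x).2 fun y _ => h y)

theorem mem_of_le {a b : A} (h : a ≤ b) {x : X} (hx : x ∈ R.carrier a) : x ∈ R.carrier b := by
  rw [← inf_eq_left.2 h, R.mem_inf] at hx
  exact hx.2

theorem exists_of_notMem {s t : A} {z : X} (hz : z ∉ R.carrier ((t ⇨ s) ⊔ t)) :
    ∃ w, z ≤ w ∧ ¬ w ≤ z ∧ w ∈ R.carrier t ∧ w ∉ R.carrier s := by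
  rw [R.mem_sup, not_or, R.mem_himp] at hz
  push Not at hz
  obtain ⟨⟨w, hzw, hwt, hws⟩, hzt⟩ := hz
  exact ⟨w, hzw, fun h => hzt (R.upper _ h hwt), hwt, hws⟩

/-- Every point strictly above `y` is above one of at most two points strictly above `y`. -/
def AtMostTwoCovers (y : X) : Prop :=
  ∃ u₁ u₂ : X, ∀ z, y < z → (y < u₁ ∧ u₁ ≤ z) ∨ (y < u₂ ∧ u₂ ≤ z)

/-- Each point outside an element lies below a maximal such point, and the latter has at most two
covers. -/
def Branching : Prop :=
  ∀ (a : A) (x : X), x ∉ R.carrier a →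
    ∃ y, x ≤ y ∧ y ∉ R.carrier a ∧ (∀ z, y < z → z ∈ R.carrier a) ∧ AtMostTwoCovers y

/-- Pigeonhole: at a maximal point `y` refuting `p ⊔ q ⊔ r`, the premises give points above `y`
lying in exactly one of `p`, `q`, `r`, one for each. A cover of `y` lies in one of the three, so it
is below at most one of these points, and two covers cannot serve three. -/
theorem Branching.branch (h : R.Branching) (p q r : A) :
    ((p ⇨ q ⊔ r) ⇨ q ⊔ r) ⊓ ((q ⇨ p ⊔ r) ⇨ p ⊔ r) ⊓ ((r ⇨ p ⊔ q) ⇨ p ⊔ q) ≤ p ⊔ q ⊔ r := by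
  refine R.le_of_forall fun x hx => ?_
  by_contra hxu
  obtain ⟨y, hxy, hy, hmax, u₁, u₂, hu⟩ := h _ x hxu
  rw [R.mem_inf, R.mem_inf] at hx
  obtain ⟨⟨hp, hq⟩, hr⟩ := hx
  simp only [R.mem_sup, not_or] at hy
  have only : ∀ s t w : A, x ∈ R.carrier ((s ⇨ t ⊔ w) ⇨ t ⊔ w) → y ∉ R.carrier s →
      y ∉ R.carrier t → y ∉ R.carrier w →
      ∃ z, y < z ∧ z ∈ R.carrier s ∧ z ∉ R.carrier t ∧ z ∉ R.carrier w := by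
    intro s t w hx hs ht hw
    rw [R.mem_himp] at hx
    have h₁ : y ∉ R.carrier (s ⇨ t ⊔ w) := fun h => by
      have := hx y hxy h
      rw [R.mem_sup] at this
      exact this.elim ht hw
    rw [R.mem_himp] at h₁
    push Not at h₁
    obtain ⟨z, hyz, hzs, hz⟩ := h₁
    rw [R.mem_sup, not_or] at hz
    exact ⟨z, lt_of_le_of_ne hyz fun e => hs (e ▸ hzs), hzs, hz.1, hz.2⟩
  obtain ⟨zp, hzp, hp₁, hp₂, hp₃⟩ := only p q r hp hy.1.1 hy.1.2 hy.2
  obtain ⟨zq, hzq, hq₁, hq₂, hq₃⟩ := only q p r hq hy.1.2 hy.1.1 hy.2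
  obtain ⟨zr, hzr, hr₁, hr₂, hr₃⟩ := only r p q hr hy.2 hy.1.1 hy.1.2
  have one : ∀ u, y < u → (¬ u ≤ zq ∧ ¬ u ≤ zr) ∨ (¬ u ≤ zp ∧ ¬ u ≤ zr) ∨
      (¬ u ≤ zp ∧ ¬ u ≤ zq) := by
    intro u hyu
    have := hmax u hyu
    rw [R.mem_sup, R.mem_sup] at this
    rcases this with (hu | hu) | hu
    · exact Or.inl ⟨fun h => hq₂ (R.upper _ h hu), fun h => hr₂ (R.upper _ h hu)⟩
    · exact Or.inr (Or.inl ⟨fun h => hp₂ (R.upper _ h hu), fun h => hr₃ (R.upper _ h hu)⟩)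
    · exact Or.inr (Or.inr ⟨fun h => hp₃ (R.upper _ h hu), fun h => hq₃ (R.upper _ h hu)⟩)
  have h₁ := one u₁
  have h₂ := one u₂
  have h₃ := hu zp hzp
  have h₄ := hu zq hzq
  have h₅ := hu zr hzr
  tauto

/-- `a` is the complement of the principal downset of `u`. -/
def IsCoprincipal (a : A) (u : X) : Prop := ∀ x, x ∈ R.carrier a ↔ ¬ x ≤ u

theorem isCoprincipal_himp {a b : A} {u : X} (ha : u ∈ R.carrier a) (hb : u ∉ R.carrier b)
    (h : ∀ y ∈ R.carrier a, y ∉ R.carrier b → y ≤ u) : R.IsCoprincipal (a ⇨ b) u := by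
  intro x
  rw [R.mem_himp]
  constructor
  · exact fun H hxu => hb (H u hxu ha)
  · intro hxu y hxy hya
    by_contra hyb
    exact hxu (hxy.trans (h y hya hyb))

end UpsetRep

/-! ### Order combinatorics of the compactified Fine frame -/

namespace FineSpace

/-- The two descending sequences of the frame, in the order given by `e`. -/
def left (e : Bool) (i : ℕ) : FineSpace := pt (if e then .b i else .c i)

/-- The two descending sequences of the frame, in the order opposite to `left`. -/
def right (e : Bool) (i : ℕ) : FineSpace := pt (if e then .c i else .b i)

/-- Two strict pairs with neither lower point below the opposite upper point can only be parallel
steps of the chains `b` and `c`. This rigidity forces valuations refuting both `β 1` and `γ 1` into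
one shape. -/
theorem ladder {zb wb zc wc : FineSpace} (hb : zb ≤ wb) (hb' : ¬ wb ≤ zb) (hc : zc ≤ wc)
    (hc' : ¬ wc ≤ zc) (hbc : ¬ zb ≤ wc) (hcb : ¬ zc ≤ wb) :
    ∃ e k, wb = left e k ∧ zb = left e (k + 1) ∧ wc = right e k ∧ zc = right e (k + 1) := by
  suffices h : ∃ k, (wb = pt (.b k) ∧ zb = pt (.b (k + 1)) ∧ wc = pt (.c k) ∧
      zc = pt (.c (k + 1))) ∨ (wb = pt (.c k) ∧ zb = pt (.c (k + 1)) ∧ wc = pt (.b k) ∧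
      zc = pt (.b (k + 1))) by
    obtain ⟨k, h | h⟩ := h
    · exact ⟨true, k, h⟩
    · exact ⟨false, k, h⟩
  have hinj : Function.Injective pt := OnePoint.coe_injective
  rcases cases_pt wb with rfl | ⟨_ | _ | _ | _, rfl⟩ <;>
  rcases cases_pt zb with rfl | ⟨_ | _ | _ | _, rfl⟩ <;>
  simp [pt_le_pt, infty_le_pt, pt_le_infty, FineFrame.Le] at hb hb' <;>
  rcases cases_pt wc with rfl | ⟨_ | _ | _ | _, rfl⟩ <;>
  simp [pt_le_pt, infty_le_pt, pt_le_infty, FineFrame.Le] at hbc <;>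
  rcases cases_pt zc with rfl | ⟨_ | _ | _ | _, rfl⟩ <;>
  simp [pt_le_pt, infty_le_pt, pt_le_infty, FineFrame.Le] at hc hc' hcb <;>
  first
  | omega
  | (rename_i i _ _ _
     refine ⟨i, ?_⟩
     simp only [hinj.eq_iff, FineFrame.b.injEq, FineFrame.c.injEq, reduceCtorEq,
       and_false, true_and, or_false, false_or]
     omega)

theorem left_right_inj {e e' : Bool} {k l : ℕ} (h : right e k = right e' l) :
    e = e' ∧ k = l := by
  have hinj : Function.Injective pt := OnePoint.coe_injective
  have h' := hinj h
  cases e <;> cases e' <;> simp_all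

/-- Height above the point at infinity, for points other than `d i` and `∞`. -/
def rank : FineFrame → ℕ
  | .a i => i + 2
  | .b i => i
  | .c i => i
  | .d _ => 0

theorem root_le (x : FineSpace) : pt (.d 0) ≤ x := by
  rcases cases_pt x with rfl | ⟨_ | _ | _ | _, rfl⟩ <;>
    simp [pt_le_pt, pt_le_infty, FineFrame.Le]

theorem exists_maximal_of_not_d {U : Set FineSpace} (n : ℕ) :
    ∀ x : FineFrame, rank x = n → (∀ i, x ≠ .d i) → pt x ∉ U →
      ∃ y, pt x ≤ pt y ∧ pt y ∉ U ∧ ∀ z, pt y < z → z ∈ U := by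
  induction n using Nat.strong_induction_on with
  | _ n ih =>
    intro x hn hx hxU
    by_cases h : ∀ z, pt x < z → z ∈ U
    · exact ⟨x, le_rfl, hxU, h⟩
    · push Not at h
      obtain ⟨z, hz, hzU⟩ := h
      rw [lt_iff_le_not_ge] at hz
      rcases cases_pt z with rfl | ⟨z, rfl⟩
      · exact absurd ((pt_le_infty x).1 hz.1) (by simpa using hx)
      · have hzd : ∀ i, z ≠ .d i := by
          rintro i rfl
          cases x <;> simp [pt_le_pt, FineFrame.Le] at hz hx
        have hr : rank z < n := by
          cases x <;> cases z <;> simp [pt_le_pt, FineFrame.Le, rank] at * <;> omega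
        obtain ⟨y, hy, h⟩ := ih _ hr z rfl hzd hzU
        exact ⟨y, hz.1.trans hy, h⟩

/-- Clopenness rules out the two obstructions: if `∞` is outside `U` then so is some `b j` above it,
from which ascents are finite; if `∞` is in `U`, only finitely many `d j` are outside. The maximal
point is thus never `∞`. -/
theorem exists_maximal {U : Set FineSpace} (hU : IsClopen U) {x : FineSpace} (hx : x ∉ U) :
    ∃ y, x ≤ pt y ∧ pt y ∉ U ∧ ∀ z, pt y < z → z ∈ U := by
  obtain ⟨n, hn⟩ := (isClopen_iff U).1 hU
  have hinf : infty ∉ U → ∃ y, infty ≤ pt y ∧ pt y ∉ U ∧ ∀ z, pt y < z → z ∈ U := by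
    intro h
    have hb : pt (.b (n + 1)) ∉ U := fun h' => h ((hn (.b (n + 1)) (Nat.lt_succ_self n)).1 h')
    obtain ⟨y, hy, h'⟩ := exists_maximal_of_not_d _ _ rfl (by simp) hb
    exact ⟨y, le_trans (by simp [infty_le_pt]) hy, h'⟩
  rcases cases_pt x with rfl | ⟨x, rfl⟩
  · exact hinf hx
  by_cases hd : ∀ i, x ≠ .d i
  · exact exists_maximal_of_not_d _ _ rfl hd hx
  push Not at hd
  obtain ⟨i, rfl⟩ := hd
  by_cases hi : infty ∈ U
  · have hdn : ∀ j, n < j → pt (.d j) ∈ U := fun j hj => (hn (.d j) hj).2 hi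
    have key : ∀ m i, n + 1 - i = m → pt (.d i) ∉ U →
        ∃ y, pt (.d i) ≤ pt y ∧ pt y ∉ U ∧ ∀ z, pt y < z → z ∈ U := by
      intro m
      induction m using Nat.strong_induction_on with
      | _ m ih =>
        intro i hm hiU
        by_cases h : ∀ z, pt (.d i) < z → z ∈ U
        · exact ⟨_, le_rfl, hiU, h⟩
        · push Not at h
          obtain ⟨z, hz, hzU⟩ := h
          rcases cases_pt z with rfl | ⟨z, rfl⟩
          · exact absurd hi hzU
          by_cases hd : ∀ i, z ≠ .d i
          · obtain ⟨y, hy, h⟩ := exists_maximal_of_not_d _ _ rfl hd hzU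
            exact ⟨y, hz.le.trans hy, h⟩
          · push Not at hd
            obtain ⟨j, rfl⟩ := hd
            have hin : i ≤ n := by
              by_contra h
              exact hiU (hdn i (by omega))
            have hij : i < j := by
              rw [lt_iff_le_not_ge, pt_le_pt, pt_le_pt] at hz
              simp only [FineFrame.Le] at hz
              omega
            obtain ⟨y, hy, h⟩ := ih (n + 1 - j) (by omega) j rfl hzU
            exact ⟨y, hz.le.trans hy, h⟩
    exact key _ i rfl hx
  · obtain ⟨y, hy, h⟩ := hinf hi
    exact ⟨y, le_trans (by simp [pt_le_infty]) hy, h⟩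

theorem atMostTwoCovers (y : FineFrame) : UpsetRep.AtMostTwoCovers (pt y) := by
  -- The second condition handles `z = ∞`: it lies above `y` only if `y` is some `d i`, and then
  -- `u₂` has to be a `d` as well.
  have key : ∀ u₁ u₂ : FineFrame, (∀ z, y.Le z → ¬ z.Le y →
      (y.Le u₁ ∧ ¬ u₁.Le y ∧ u₁.Le z) ∨ (y.Le u₂ ∧ ¬ u₂.Le y ∧ u₂.Le z)) →
      ((∃ i, y = .d i) → (∃ i, u₂ = .d i) ∧ y.Le u₂ ∧ ¬ u₂.Le y) →
      UpsetRep.AtMostTwoCovers (pt y) := by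
    intro u₁ u₂ h h'
    refine ⟨pt u₁, pt u₂, fun z hz => ?_⟩
    simp only [lt_iff_le_not_ge] at hz ⊢
    rcases cases_pt z with rfl | ⟨z, rfl⟩
    · obtain ⟨h₁, h₂⟩ := h' ((pt_le_infty y).1 hz.1)
      exact Or.inr ⟨h₂, (pt_le_infty u₂).2 h₁⟩
    · simp only [pt_le_pt] at *
      rcases h z hz.1 hz.2 with h | h
      · exact Or.inl ⟨⟨h.1, h.2.1⟩, h.2.2⟩
      · exact Or.inr ⟨⟨h.1, h.2.1⟩, h.2.2⟩
  rcases y with i | i | i | i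
  · refine key (.b (i + 1)) (.c (i + 1)) ?_ (by simp)
    rintro (_ | _ | _ | _) h h' <;> simp [FineFrame.Le] at h h' ⊢ <;> omega
  · rcases i with _ | _ | i
    · refine key (.b 0) (.b 0) ?_ (by simp)
      rintro (_ | _ | _ | _) h h' <;> simp [FineFrame.Le] at h h' ⊢
    · refine key (.b 0) (.b 0) ?_ (by simp)
      rintro (_ | _ | _ | _) h h' <;> simp [FineFrame.Le] at h h' ⊢ <;> omega
    · refine key (.b (i + 1)) (.c i) ?_ (by simp)
      rintro (_ | _ | _ | _) h h' <;> simp [FineFrame.Le] at h h' ⊢ <;> omega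
  · rcases i with _ | _ | i
    · refine key (.c 0) (.c 0) ?_ (by simp)
      rintro (_ | _ | _ | _) h h' <;> simp [FineFrame.Le] at h h' ⊢
    · refine key (.c 0) (.c 0) ?_ (by simp)
      rintro (_ | _ | _ | _) h h' <;> simp [FineFrame.Le] at h h' ⊢ <;> omega
    · refine key (.c (i + 1)) (.b i) ?_ (by simp)
      rintro (_ | _ | _ | _) h h' <;> simp [FineFrame.Le] at h h' ⊢ <;> omega
  · refine key (.a i) (.d (i + 1)) ?_ (fun _ => ⟨⟨_, rfl⟩, by simp [FineFrame.Le]⟩)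
    rintro (_ | _ | _ | _) h h' <;> simp [FineFrame.Le] at h h' ⊢ <;> omega

end FineSpace

/-! ### The Fine algebra validates the Shehtman axioms and refutes `delta 0` -/

namespace FineAlgebra

open FineSpace Shehtman

/-- The elements of the algebra as upsets. -/
def rep : UpsetRep FineAlgebra FineSpace where
  carrier U := U
  upper U := U.upper
  eq_top U h := SetLike.coe_injective (Set.eq_univ_of_forall h)
  mem_top _ := trivial
  mem_bot _ := id
  mem_inf _ _ _ := Iff.rfl
  mem_sup _ _ _ := Iff.rfl
  mem_himp U V x := by
    change x ∈ {x | ∃ y ∈ (U : Set FineSpace) \ V, x ≤ y}ᶜ ↔ _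
    simp only [Set.mem_compl_iff, Set.mem_ofPred_eq, Set.mem_sdiff]
    push Not
    exact ⟨fun h y hxy hy => by_contra fun hV => h y ⟨hy, hV⟩ hxy,
      fun h y hy hxy => hy.2 (h y hxy hy.1)⟩
  mem_sdiff U V x := by
    change x ∈ {x | ∃ y ∈ (U : Set FineSpace) \ V, y ≤ x} ↔ _
    simp only [Set.mem_ofPred_eq, Set.mem_sdiff]
    exact exists_congr fun y => and_comm

theorem branching : rep.Branching := by
  intro U x hx
  obtain ⟨y, hxy, hy, h⟩ := exists_maximal U.isClopen hx
  exact ⟨pt y, hxy, hy, h, atMostTwoCovers y⟩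

/-- The values of `β` and `γ` at `n + 1` are the complements of the downsets generated by
corresponding points of the two descending sequences. -/
structure Canonical (p q : FineAlgebra) (e : Bool) (k n : ℕ) : Prop where
  b_succ : rep.IsCoprincipal (b p q (n + 1)) (left e (k + 1))
  c_succ : rep.IsCoprincipal (c p q (n + 1)) (right e (k + 1))
  left_mem : left e (k + 1) ∈ rep.carrier (c p q n)
  left_notMem : left e (k + 2) ∉ rep.carrier (c p q n)
  right_mem : right e (k + 1) ∈ rep.carrier (b p q n)
  right_notMem : right e (k + 2) ∉ rep.carrier (b p q n)

theorem left_lt_cases {e : Bool} {k : ℕ} {y : FineSpace} (h₁ : ¬ y ≤ right e (k + 1))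
    (h₂ : y ≤ left e (k + 1)) : y = left e (k + 1) ∨ y ≤ left e (k + 2) := by
  cases e <;> rcases cases_pt y with rfl | ⟨_ | _ | _ | i, rfl⟩ <;>
    simp [left, right, pt_le_pt, infty_le_pt, FineFrame.Le] at * <;>
    first
    | omega
    | (rw [or_iff_not_imp_right]
       intro h
       congr 2
       omega)

theorem right_lt_cases {e : Bool} {k : ℕ} {y : FineSpace} (h₁ : ¬ y ≤ left e (k + 1))
    (h₂ : y ≤ right e (k + 1)) : y = right e (k + 1) ∨ y ≤ right e (k + 2) := by
  have := left_lt_cases (e := !e) (k := k) (y := y)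
  cases e <;> exact this h₁ h₂

theorem left_order (e : Bool) (k : ℕ) : left e (k + 1) ≤ left e k ∧ left e (k + 2) ≤ right e k ∧
    right e (k + 1) ≤ right e k ∧ right e (k + 2) ≤ left e k ∧ ¬ left e (k + 1) ≤ right e k ∧
    ¬ right e (k + 1) ≤ left e k ∧ ¬ left e k ≤ left e (k + 1) ∧
    ¬ right e k ≤ right e (k + 1) := by
  cases e <;> simp [left, right, pt_le_pt, FineFrame.Le]

/-- A point refuting the next `β` is below `left e (k+1)`, not below `right e (k+1)` and outside `γ
n`. The last condition excludes `left e (k+1)` itself, so the point is below `left e (k+2)`; dually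
for `γ`. -/
theorem Canonical.succ {p q : FineAlgebra} {e : Bool} {k n : ℕ} (h : Canonical p q e k n) :
    Canonical p q e (k + 1) (n + 1) := by
  have o₁ := left_order e (k + 1)
  refine ⟨?_, ?_, ?_, ?_, ?_, ?_⟩
  · change rep.IsCoprincipal (b p q (n + 2)) _
    rw [b_add_two]
    refine rep.isCoprincipal_himp ?_ ?_ ?_
    · rw [h.c_succ]; exact o₁.2.2.2.2.1
    · rw [rep.mem_sup, h.b_succ, not_or, not_not]
      exact ⟨o₁.1, h.left_notMem⟩
    · intro y hy hy'
      rw [h.c_succ] at hy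
      rw [rep.mem_sup, h.b_succ, not_or, not_not] at hy'
      exact (left_lt_cases hy hy'.1).resolve_left fun e => hy'.2 (e ▸ h.left_mem)
  · change rep.IsCoprincipal (c p q (n + 2)) _
    rw [c_add_two]
    refine rep.isCoprincipal_himp ?_ ?_ ?_
    · rw [h.b_succ]; exact o₁.2.2.2.2.2.1
    · rw [rep.mem_sup, h.c_succ, not_or, not_not]
      exact ⟨o₁.2.2.1, h.right_notMem⟩
    · intro y hy hy'
      rw [h.b_succ] at hy
      rw [rep.mem_sup, h.c_succ, not_or, not_not] at hy'
      exact (right_lt_cases hy hy'.1).resolve_left fun e => hy'.2 (e ▸ h.right_mem)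
  · rw [h.c_succ]; exact o₁.2.2.2.2.1
  · rw [h.c_succ, not_not]; exact o₁.2.1
  · rw [h.b_succ]; exact o₁.2.2.2.2.2.1
  · rw [h.b_succ, not_not]; exact o₁.2.2.2.1

theorem Canonical.add {p q : FineAlgebra} {e : Bool} {k : ℕ} (h : Canonical p q e k 0) (n : ℕ) :
    Canonical p q e (k + n) n := by
  induction n with
  | zero => exact h
  | succ n ih => exact ih.succ

theorem Canonical.a {p q : FineAlgebra} {e : Bool} {k n : ℕ} (h : Canonical p q e k n) :
    rep.IsCoprincipal (a p q n) (pt (.a k)) := by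
  have h' := h.succ
  refine rep.isCoprincipal_himp ?_ ?_ ?_
  · rw [rep.mem_inf, h'.b_succ, h'.c_succ]
    cases e <;> simp [left, right, pt_le_pt, FineFrame.Le]
  · rw [rep.mem_sup, h.b_succ, h.c_succ]
    cases e <;> simp [left, right, pt_le_pt, FineFrame.Le]
  · intro y hy hy'
    rw [rep.mem_inf, h'.b_succ, h'.c_succ] at hy
    rw [rep.mem_sup, h.b_succ, h.c_succ] at hy'
    cases e <;> rcases cases_pt y with rfl | ⟨_ | _ | _ | i, rfl⟩ <;>
      simp [left, right, pt_le_pt, infty_le_pt, FineFrame.Le] at * <;> omega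

/-- Refutations of `β 1` and `γ 1` form a configuration as in `ladder`. Any other refutation of one,
paired with the fixed refutation of the other, is again such a configuration, so the refuting points
are unique. -/
theorem exists_canonical {p q : FineAlgebra} (hb : b p q 1 ≠ ⊤) (hc : c p q 1 ≠ ⊤) :
    ∃ e k, Canonical p q e k 0 := by
  have key : ∀ s t : FineAlgebra, ((s ⇨ t) ⇨ (t ⇨ s) ⊔ t) ≠ ⊤ →
      ∃ z, z ∈ rep.carrier (s ⇨ t) ∧ z ∉ rep.carrier ((t ⇨ s) ⊔ t) := by
    intro s t h
    contrapose! h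
    exact rep.eq_top _ fun x => (rep.mem_himp _ _ _).2 fun y _ => h y
  have sep : ∀ s t : FineAlgebra, ∀ z w, z ∈ rep.carrier (s ⇨ t) → w ∈ rep.carrier s →
      w ∉ rep.carrier t → ¬ z ≤ w := by
    intro s t z w hz hws hwt hzw
    exact hwt ((rep.mem_himp _ _ _).1 hz w hzw hws)
  obtain ⟨zb, hzb, hzb'⟩ := key p q hb
  obtain ⟨zc, hzc, hzc'⟩ := key q p hc
  obtain ⟨wb, hb₁, hb₂, hb₃, hb₄⟩ := rep.exists_of_notMem hzb'
  obtain ⟨wc, hc₁, hc₂, hc₃, hc₄⟩ := rep.exists_of_notMem hzc'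
  obtain ⟨e, k, rfl, rfl, rfl, rfl⟩ := ladder hb₁ hb₂ hc₁ hc₂ (sep _ _ _ _ hzb hc₃ hc₄)
    (sep _ _ _ _ hzc hb₃ hb₄)
  have o := left_order e k
  refine ⟨e, k, ?_, ?_, hzb, ?_, hzc, ?_⟩
  · refine rep.isCoprincipal_himp hzb hzb' fun y hy hy' => ?_
    obtain ⟨w, h₁, h₂, h₃, h₄⟩ := rep.exists_of_notMem hy'
    obtain ⟨e', k', -, rfl, h, -⟩ := ladder h₁ h₂ hc₁ hc₂ (sep _ _ _ _ hy hc₃ hc₄)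
      (sep _ _ _ _ hzc h₃ h₄)
    obtain ⟨rfl, rfl⟩ := left_right_inj h
    exact le_rfl
  · refine rep.isCoprincipal_himp hzc hzc' fun y hy hy' => ?_
    obtain ⟨w, h₁, h₂, h₃, h₄⟩ := rep.exists_of_notMem hy'
    obtain ⟨e', k', -, h, -, rfl⟩ := ladder hb₁ hb₂ h₁ h₂ (sep _ _ _ _ hzb h₃ h₄)
      (sep _ _ _ _ hy hb₃ hb₄)
    have h' : right (!e) (k + 1) = right (!e') (k' + 1) := by cases e <;> cases e' <;> exact h
    obtain ⟨he, hk⟩ := left_right_inj h'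
    obtain rfl : e = e' := by simpa using he
    obtain rfl : k = k' := by omega
    exact le_rfl
  · exact fun h => sep _ _ _ _ h hc₃ hc₄ o.2.1
  · exact fun h => sep _ _ _ _ h hb₃ hb₄ o.2.2.2.1

theorem validatesShehtman : ValidatesShehtman FineAlgebra := by
  have key : ∀ p q : FineAlgebra, (∀ n, Shehtman.a p q n = ⊤) ∨ ∃ e k, Canonical p q e k 0 := by
    intro p q
    by_cases hb : b p q 1 = ⊤
    · exact Or.inl (a_eq_top (by simp [hb]))
    by_cases hc : c p q 1 = ⊤
    · exact Or.inl (a_eq_top (by simp [hc]))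
    exact Or.inr (exists_canonical hb hc)
  refine ⟨fun p q => ?_, fun p q => ?_, branching.branch⟩
  · rcases key p q with h | ⟨e, k, h⟩
    · simp [h]
    have h₀ := h.a
    have h₁ := (h.add 1).a
    have h₂ := (h.add 2).a
    -- The points below both `a (k+1)` and `a (k+2)` are the `d i` with `i ≤ k + 1`; of these only
    -- `d (k+1)` is not below `a k`.
    have hd : rep.IsCoprincipal (Shehtman.a p q 0 ⇨ Shehtman.a p q 1 ⊔ Shehtman.a p q 2)
        (pt (.d (k + 1))) := by
      refine rep.isCoprincipal_himp ?_ ?_ ?_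
      · rw [h₀]
        simp [pt_le_pt, FineFrame.Le]
      · rw [rep.mem_sup, h₁, h₂]
        simp [pt_le_pt, FineFrame.Le]
      · intro y _ hy
        rw [rep.mem_sup, h₁, h₂] at hy
        rcases cases_pt y with rfl | ⟨_ | _ | _ | i, rfl⟩ <;>
          simp [pt_le_pt, infty_le_pt, FineFrame.Le] at * <;> omega
    refine rep.le_of_forall fun x hx => ?_
    rw [hd] at hx
    rw [rep.mem_sup, h₀, h₁]
    rcases cases_pt x with rfl | ⟨_ | _ | _ | i, rfl⟩ <;>
      simp [pt_le_pt, infty_le_pt, FineFrame.Le] at * <;> omega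
  · rcases key p q with h | ⟨e, k, h⟩
    · simp [h]
    refine rep.le_of_forall fun x hx => ?_
    rw [(h.add 1).a] at hx
    rw [rep.mem_sup, h.a, (h.add 1).b_succ]
    cases e <;> rcases cases_pt x with rfl | ⟨_ | _ | _ | i, rfl⟩ <;>
      simp [left, pt_le_pt, infty_le_pt, FineFrame.Le] at * <;> omega

/-- The clopen upset that consists of one maximal point. -/
def singleton (x : FineFrame) (hx : ∀ y, x.Le y → y = x) (hx' : ∃ i, x = .b i ∨ x = .c i) :
    FineAlgebra where
  carrier := {pt x}
  isClopen' := by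
    rw [isClopen_iff]
    refine ⟨x.idx, fun y hy => iff_of_false ?_ ?_⟩
    · intro h
      have : y = x := OnePoint.coe_injective h
      exact absurd hy (by simp [this])
    · exact fun h => OnePoint.infty_ne_coe x h
  upper' := by
    rintro _ z hz rfl
    rcases cases_pt z with rfl | ⟨z, rfl⟩
    · obtain ⟨i, hi⟩ := (pt_le_infty x).1 hz
      obtain ⟨j, hj | hj⟩ := hx' <;> simp [hi] at hj
    · exact congrArg pt (hx z hz)

theorem delta_zero_not_mem : HBFormula.delta 0 ∉ FineLogic := by
  intro h
  let p : FineAlgebra := singleton (.c 0)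
    (by rintro (_ | _ | _ | _) <;> simp [FineFrame.Le]) ⟨0, Or.inr rfl⟩
  let q : FineAlgebra := singleton (.b 0)
    (by rintro (_ | _ | _ | _) <;> simp [FineFrame.Le]) ⟨0, Or.inl rfl⟩
  have hp : ∀ x, x ∈ rep.carrier p ↔ x = pt (.c 0) := fun x => Iff.rfl
  have hq : ∀ x, x ∈ rep.carrier q ↔ x = pt (.b 0) := fun x => Iff.rfl
  have hinj : Function.Injective pt := OnePoint.coe_injective
  have hc : rep.IsCoprincipal (c p q 0) (pt (.c 0)) := by
    refine rep.isCoprincipal_himp ((hp _).2 rfl) ?_ fun y hy _ => ((hp _).1 hy).le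
    rw [hq, hinj.eq_iff]; simp
  have hb : rep.IsCoprincipal (b p q 0) (pt (.b 0)) := by
    refine rep.isCoprincipal_himp ((hq _).2 rfl) ?_ fun y hy _ => ((hq _).1 hy).le
    rw [hp, hinj.eq_iff]; simp
  -- The point `b 1` refutes `β 1`: it is not below `c 0`, but it is below `b 0` and distinct from
  -- it.
  have hb₁ : b p q 1 ≠ ⊤ := by
    intro h
    have h₁ := rep.mem_top (pt (.b 1))
    rw [← h, b_one, rep.mem_himp] at h₁
    have h₂ := h₁ _ le_rfl ((hc _).2 (by simp [pt_le_pt, FineFrame.Le]))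
    rw [rep.mem_sup, ← b_zero p q, hb, hq, hinj.eq_iff] at h₂
    simp [pt_le_pt, FineFrame.Le] at h₂
  have hc₁ : c p q 1 ≠ ⊤ := by
    intro h
    have h₁ := rep.mem_top (pt (.c 1))
    rw [← h, c_one, rep.mem_himp] at h₁
    have h₂ := h₁ _ le_rfl ((hb _).2 (by simp [pt_le_pt, FineFrame.Le]))
    rw [rep.mem_sup, ← c_zero p q, hc, hp, hinj.eq_iff] at h₂
    simp [pt_le_pt, FineFrame.Le] at h₂
  obtain ⟨e, k, hk⟩ := exists_canonical hb₁ hc₁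
  have h₁ := h fun n => if n = 0 then p else q
  simp only [HBFormula.delta, HBFormula.eval_or, HBFormula.eval_alpha] at h₁
  have h₂ : pt (.d 0) ∈ rep.carrier (Shehtman.a p q 0 ⊔ Shehtman.a p q 1) := by
    have := rep.mem_top (pt (.d 0))
    rw [← h₁] at this
    simpa using this
  rw [rep.mem_sup, hk.a, (hk.add 1).a] at h₂
  simp [root_le] at h₂

end FineAlgebra

/-! Formulas that separate the logics of fences with marked ends. -/

section Box

variable {A : Type*} [BiheytingAlgebra A]

/-- The operation `¬∼`. -/
def biBox (a : A) : A := ⊤ \ a ⇨ ⊥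

/-- An element whose points have three incomparable points below them. -/
def threeBelow (a b c : A) : A :=
  ⊤ \ a ⊓ ⊤ \ b ⊓ ⊤ \ c ⊓ (biBox (a ⊔ b) ⊓ biBox (a ⊔ c) ⊓ biBox (b ⊔ c))

end Box

namespace HBFormula

/-- The operation `¬∼` on formulas. -/
def box (φ : HBFormula) : HBFormula := φ.coneg.neg

/-- The formula for `threeBelow` in the variables `i`, `i + 1`, `i + 2`. -/
def three (i : ℕ) : HBFormula :=
  and (and (and (var i).coneg (var (i + 1)).coneg) (var (i + 2)).coneg)
    (and (and (or (var i) (var (i + 1))).box (or (var i) (var (i + 2))).box)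
      (or (var (i + 1)) (var (i + 2))).box)

/-- No two points with three incomparable points below them have distance `n + 1`. -/
def apart (n : ℕ) : HBFormula :=
  imp (and (three 0) (box^[n] (three 3).neg)) (box^[n + 1] (three 3).neg)

variable {A : Type*} [BiheytingAlgebra A]

@[simp] theorem eval_box (v : ℕ → A) (φ : HBFormula) : φ.box.eval v = biBox (φ.eval v) := by
  simp [box, biBox]

@[simp] theorem eval_iterate_box (v : ℕ → A) (n : ℕ) (φ : HBFormula) :
    (box^[n] φ).eval v = biBox^[n] (φ.eval v) := by
  induction n with
  | zero => rfl
  | succ n ih => rw [Function.iterate_succ_apply', Function.iterate_succ_apply', eval_box, ih]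

@[simp] theorem eval_three (v : ℕ → A) (i : ℕ) :
    (three i).eval v = threeBelow (v i) (v (i + 1)) (v (i + 2)) := by
  simp [three, threeBelow]

end HBFormula

namespace UpsetRep

variable {A : Type*} [BiheytingAlgebra A] {X : Type*} [PartialOrder X] (R : UpsetRep A X)

theorem mem_himp_bot (a : A) (x : X) :
    x ∈ R.carrier (a ⇨ ⊥) ↔ ∀ y, x ≤ y → y ∉ R.carrier a := by
  simp only [R.mem_himp, R.mem_bot]

theorem mem_top_sdiff (a : A) (x : X) :
    x ∈ R.carrier (⊤ \ a) ↔ ∃ y, y ≤ x ∧ y ∉ R.carrier a := by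
  simp only [R.mem_sdiff, R.mem_top, true_and]

theorem mem_biBox (a : A) (x : X) :
    x ∈ R.carrier (biBox a) ↔ ∀ y, x ≤ y → ∀ z, z ≤ y → z ∈ R.carrier a := by
  simp only [biBox, R.mem_himp_bot, R.mem_top_sdiff]
  push Not
  rfl

theorem mem_of_mem_biBox {a : A} {x : X} (h : x ∈ R.carrier (biBox a)) : x ∈ R.carrier a :=
  (R.mem_biBox a x).1 h x le_rfl x le_rfl

theorem mem_iterate_biBox_of_le {a : A} {x : X} {m n : ℕ} (hmn : m ≤ n)
    (h : x ∈ R.carrier (biBox^[n] a)) : x ∈ R.carrier (biBox^[m] a) := by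
  induction hmn with
  | refl => exact h
  | step _ ih =>
    rw [Function.iterate_succ_apply'] at h
    exact ih (R.mem_of_mem_biBox h)

/-- A single box already reaches the root, so its argument holds everywhere and further boxes cost
nothing. The index `n + 1` guarantees a box in the premise. -/
theorem apart_validIn_of_root (R : UpsetRep A X) {r : X} (hr : ∀ x, r ≤ x) (n : ℕ) :
    (HBFormula.apart (n + 1)).ValidIn A := by
  intro v
  simp only [HBFormula.apart, HBFormula.eval_imp, HBFormula.eval_and,
    HBFormula.eval_iterate_box, himp_eq_top_iff]
  refine R.le_of_forall fun x hx => ?_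
  rw [R.mem_inf, Function.iterate_succ_apply', R.mem_biBox] at hx
  have hall := fun z => R.upper _ (hr z) (hx.2 x le_rfl r (hr x))
  rw [Function.iterate_succ_apply', Function.iterate_succ_apply', R.mem_biBox]
  intro y _ z _
  rw [R.mem_biBox]
  exact fun _ _ w _ => hall w

/-- Each point below `x` misses at most one of `a`, `b`, `c`, and each of the three is missed. The
witnesses are distinct, and differ from `x` because upsets pull `x` into all three: too many for `u`
and `v`. -/
theorem notMem_threeBelow {a b c : A} {x u v : X} (h : ∀ z, z ≤ x → z = x ∨ z = u ∨ z = v) :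
    x ∉ R.carrier (threeBelow a b c) := by
  intro hx
  simp only [threeBelow, R.mem_inf, R.mem_top_sdiff, R.mem_biBox, R.mem_sup] at hx
  obtain ⟨⟨⟨⟨y₁, h₁, ha⟩, y₂, h₂, hb⟩, y₃, h₃, hc⟩, ⟨hab, hac⟩, hbc⟩ := hx
  have ab := hab x le_rfl
  have ac := hac x le_rfl
  have bc := hbc x le_rfl
  have y₁b := (ab y₁ h₁).resolve_left ha
  have y₁c := (ac y₁ h₁).resolve_left ha
  have y₂a := (ab y₂ h₂).resolve_right hb
  have y₂c := (bc y₂ h₂).resolve_left hb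
  have y₃a := (ac y₃ h₃).resolve_right hc
  have xa := R.upper _ h₂ y₂a
  have xb := R.upper _ h₁ y₁b
  have xc := R.upper _ h₁ y₁c
  have e₁₂ : y₁ ≠ y₂ := fun e => ha (e ▸ y₂a)
  have e₁₃ : y₁ ≠ y₃ := fun e => ha (e ▸ y₃a)
  have e₂₃ : y₂ ≠ y₃ := fun e => hc (e ▸ y₂c)
  have e₁ : y₁ ≠ x := fun e => ha (e ▸ xa)
  have e₂ : y₂ ≠ x := fun e => hb (e ▸ xb)
  have e₃ : y₃ ≠ x := fun e => hc (e ▸ xc)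
  have d₁ := (h y₁ h₁).resolve_left e₁
  have d₂ := (h y₂ h₂).resolve_left e₂
  have d₃ := (h y₃ h₃).resolve_left e₃
  grind

/-- The upsets of a partial order, as lower sets of its dual, represent themselves. -/
def ofOrder (X : Type*) [PartialOrder X] : UpsetRep (LowerSet Xᵒᵈ) X where
  carrier U := {x | OrderDual.toDual x ∈ U}
  upper U _ _ hxy hx := U.lower hxy hx
  eq_top U h := SetLike.coe_injective (Set.eq_univ_of_forall h)
  mem_top _ := trivial
  mem_bot _ := id
  mem_inf _ _ _ := Iff.rfl
  mem_sup _ _ _ := Iff.rfl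
  mem_himp U V x := by
    constructor
    · intro h y hxy hy
      have : (U ⇨ V) ⊓ U ≤ V := himp_inf_le
      exact this ⟨(U ⇨ V).lower (show OrderDual.toDual y ≤ OrderDual.toDual x from hxy) h, hy⟩
    · intro h
      have : LowerSet.Iic (OrderDual.toDual x) ≤ U ⇨ V := by
        rw [le_himp_iff]
        rintro y ⟨hy, hyU⟩
        exact h (OrderDual.ofDual y) hy hyU
      exact this le_rfl
  mem_sdiff U V x := by
    constructor
    · intro h
      let W : LowerSet Xᵒᵈ := ⟨{x | ∃ y, x ≤ y ∧ y ∈ U ∧ y ∉ V},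
        fun _ _ hle ⟨y, hy, h⟩ => ⟨y, hle.trans hy, h⟩⟩
      have hW : U \ V ≤ W := by
        rw [sdiff_le_iff]
        intro y hy
        by_cases hV : y ∈ V
        · exact Or.inl hV
        · exact Or.inr ⟨y, le_rfl, hy, hV⟩
      exact hW h
    · rintro ⟨y, hyx, hU, hV⟩
      have : U ≤ V ⊔ U \ V := le_sup_sdiff
      exact (U \ V).lower (show OrderDual.toDual x ≤ OrderDual.toDual y from hyx)
        ((this hU).resolve_left hV)

end UpsetRep

/-! ### Fences and the distance between their ends -/

/-- A zigzag with maximal points `t 0, …, t N` whose two ends lie above at least three minimal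
points. (The points `t i` with `N < i` are isolated.) -/
inductive Fence (N : ℕ) : Type
  | s (j : ℕ) : Fence N
  | t (i : ℕ) : Fence N

namespace Fence

variable {N : ℕ}

/-- The order of the fence: each `s j` lies below at most two consecutive maximal points. -/
def Le : Fence N → Fence N → Prop
  | s j, s k => j = k
  | s j, t i => i = min N (j - 2) ∨ i = min N (j - 1)
  | t _, s _ => False
  | t i, t k => i = k

instance : PartialOrder (Fence N) where
  le := Le
  le_refl x := by cases x <;> simp [Le]
  le_trans x y z h₁ h₂ := by
    cases x <;> cases y <;> cases z <;> simp only [Le] at * <;> omega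
  le_antisymm x y h₁ h₂ := by
    cases x <;> cases y <;> simp only [Le, s.injEq, t.injEq] at * <;> omega

theorem s_le_s {j k : ℕ} : (s j : Fence N) ≤ s k ↔ j = k := Iff.rfl

theorem s_le_t {j i : ℕ} : (s j : Fence N) ≤ t i ↔ i = min N (j - 2) ∨ i = min N (j - 1) := Iff.rfl

theorem t_le_t {i k : ℕ} : (t i : Fence N) ≤ t k ↔ i = k := Iff.rfl

theorem not_t_le_s {i j : ℕ} : ¬ (t i : Fence N) ≤ s j := id

/-- The least index of a maximal point above a point. -/
def lo : Fence N → ℕ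
  | s j => min N (j - 2)
  | t i => i

/-- The greatest index of a maximal point above a point. -/
def hi : Fence N → ℕ
  | s j => min N (j - 1)
  | t i => i

theorem hi_le {x y z : Fence N} (hxy : x ≤ y) (hzy : z ≤ y) : hi z ≤ hi x + 1 := by
  cases x <;> cases y <;> cases z <;>
    simp only [s_le_s, s_le_t, t_le_t, not_t_le_s, hi] at * <;> omega

theorem lo_le {x y z : Fence N} (hxy : x ≤ y) (hzy : z ≤ y) : lo x ≤ lo z + 1 := by
  cases x <;> cases y <;> cases z <;>
    simp only [s_le_s, s_le_t, t_le_t, not_t_le_s, lo] at * <;> omega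

/-- The bi-Heyting algebra of upsets of a fence. -/
abbrev Alg (N : ℕ) : Type := LowerSet (Fence N)ᵒᵈ

/-- The elements of the algebra as upsets. -/
def rep (N : ℕ) : UpsetRep (Alg N) (Fence N) := UpsetRep.ofOrder (Fence N)

theorem branching (N : ℕ) : (rep N).Branching := by
  have hcov : ∀ x : Fence N, UpsetRep.AtMostTwoCovers x := by
    rintro (j | i)
    · refine ⟨t (min N (j - 2)), t (min N (j - 1)), ?_⟩
      rintro (k | i) h <;> simp only [lt_iff_le_not_ge, s_le_s, s_le_t, t_le_t, not_t_le_s,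
        not_false_eq_true, and_true, true_or, or_true, true_and] at * <;> omega
    · refine ⟨t i, t i, ?_⟩
      rintro (k | i) h <;> simp only [lt_iff_le_not_ge, t_le_t, not_t_le_s] at h
      · exact h.1.elim
      · exact absurd h.1.symm h.2
  have hmax : ∀ i z, ¬ (t i : Fence N) < z := by
    rintro i (k | k) h <;> simp only [lt_iff_le_not_ge, t_le_t, not_t_le_s] at h
    · exact h.1.elim
    · exact h.2 h.1.symm
  intro a x hx
  by_cases h : ∀ z, x < z → z ∈ (rep N).carrier a
  · exact ⟨x, le_rfl, hx, h, hcov x⟩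
  · push Not at h
    obtain ⟨k | k, hz, hza⟩ := h
    · cases x <;> simp only [lt_iff_le_not_ge, s_le_s, not_t_le_s] at hz
      · exact absurd hz.1.symm hz.2
      · exact hz.1.elim
    · exact ⟨t k, hz.le, hza, fun z h => absurd h (hmax k z), hcov _⟩

open Shehtman in
-- In height two, a refutation of `β 1` or `γ 1` must occur at the point itself, with nothing
-- strictly between. One point cannot refute both, since the first puts it in `p ⇨ q` and the second
-- keeps it out. So every `α n` is `⊤`.
theorem validatesShehtman (N : ℕ) : ValidatesShehtman (Alg N) := by
  have key : ∀ s t : Alg N, ∀ x, x ∉ (rep N).carrier ((s ⇨ t) ⇨ (t ⇨ s) ⊔ t) →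
      x ∈ (rep N).carrier (s ⇨ t) ∧ x ∉ (rep N).carrier ((t ⇨ s) ⊔ t) := by
    intro s t x hx
    rw [(rep N).mem_himp] at hx
    push Not at hx
    obtain ⟨y, hxy, hy, hy'⟩ := hx
    obtain ⟨w, hyw, hwy, -⟩ := (rep N).exists_of_notMem hy'
    have : x = y := by
      cases x <;> cases y <;> cases w <;>
        simp only [s_le_s, s_le_t, t_le_t, not_t_le_s, Fence.s.injEq, Fence.t.injEq] at * <;> omega
    exact this ▸ ⟨hy, hy'⟩
  have top : ∀ p q : Alg N, ∀ n, a p q n = ⊤ := by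
    intro p q
    refine a_eq_top ((rep N).eq_top _ fun x => ?_)
    rw [(rep N).mem_sup]
    by_contra hx
    rw [not_or] at hx
    have h₁ := key p q x hx.1
    have h₂ := key q p x hx.2
    exact h₂.2 ((rep N).mem_sup _ _ _ |>.2 (Or.inl h₁.1))
  exact ⟨fun p q => by simp [top], fun p q => by simp [top], (branching N).branch⟩

theorem mem_iterate_of_hi {V : Alg N} {M : ℕ} (hV : ∀ z, hi z < M → z ∈ (rep N).carrier V) (k : ℕ) :
    ∀ x, hi x + k < M → x ∈ (rep N).carrier (biBox^[k] V) := by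
  induction k with
  | zero => exact hV
  | succ k ih =>
    intro x hx
    rw [Function.iterate_succ_apply', (rep N).mem_biBox]
    intro y hxy z hzy
    exact ih z (by have := hi_le hxy hzy; omega)

theorem mem_iterate_of_lo {V : Alg N} {M : ℕ} (hV : ∀ z, M < lo z → z ∈ (rep N).carrier V) (k : ℕ) :
    ∀ x, M + k < lo x → x ∈ (rep N).carrier (biBox^[k] V) := by
  induction k with
  | zero => exact hV
  | succ k ih =>
    intro x hx
    rw [Function.iterate_succ_apply', (rep N).mem_biBox]
    intro y hxy z hzy
    exact ih z (by have := lo_le hxy hzy; omega)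

theorem s_notMem_iterate_of_add {V : Alg N} (k : ℕ) :
    ∀ j, s (j + k) ∉ (rep N).carrier V → s j ∉ (rep N).carrier (biBox^[k] V) := by
  induction k with
  | zero => exact fun j h => h
  | succ k ih =>
    intro j hj h
    rw [Function.iterate_succ_apply', (rep N).mem_biBox] at h
    refine ih (j + 1) (by rwa [show j + 1 + k = j + (k + 1) by omega]) ?_
    exact h (t (min N (j - 1))) (s_le_t.2 (Or.inr rfl)) _ (s_le_t.2 (Or.inl rfl))

theorem s_add_notMem_iterate {V : Alg N} (k : ℕ) :
    ∀ j, s j ∉ (rep N).carrier V → s (j + k) ∉ (rep N).carrier (biBox^[k] V) := by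
  induction k with
  | zero => exact fun j h => h
  | succ k ih =>
    intro j hj h
    rw [Function.iterate_succ_apply', (rep N).mem_biBox] at h
    refine ih j hj ?_
    exact h (t (min N (j + k - 1))) (s_le_t.2 (Or.inl (by omega))) _ (s_le_t.2 (Or.inr rfl))

theorem t_zero_notMem_iterate {V : Alg (N + 1)} (h : s (N + 2) ∉ (rep (N + 1)).carrier V) :
    t 0 ∉ (rep (N + 1)).carrier (biBox^[N + 1] V) := by
  rw [Function.iterate_succ_apply', (rep _).mem_biBox]
  intro h'
  exact s_notMem_iterate_of_add N 2 (by rwa [add_comm 2 N])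
    (h' _ le_rfl _ (s_le_t.2 (Or.inl (by omega))))

theorem t_last_notMem_iterate {V : Alg (N + 1)} (h : s 2 ∉ (rep (N + 1)).carrier V) :
    t (N + 1) ∉ (rep (N + 1)).carrier (biBox^[N + 1] V) := by
  rw [Function.iterate_succ_apply', (rep _).mem_biBox]
  intro h'
  exact s_add_notMem_iterate N 2 h (h' _ le_rfl _ (s_le_t.2 (Or.inr (by omega))))

theorem eq_of_mem_threeBelow {a b c : Alg N} {x : Fence N}
    (hx : x ∈ (rep N).carrier (threeBelow a b c)) : x = t 0 ∨ x = t N := by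
  rcases x with j | i
  · refine absurd hx ((rep N).notMem_threeBelow (u := s j) (v := s j) ?_)
    rintro (k | k) h
    · exact Or.inl (congrArg s h)
    · exact h.elim
  · by_contra hi
    rw [not_or, t.injEq, t.injEq] at hi
    refine absurd hx ((rep N).notMem_threeBelow (u := s (i + 1)) (v := s (i + 2)) ?_)
    rintro (k | k) h <;> simp only [s_le_t, t_le_t, s.injEq, t.injEq, reduceCtorEq] at h ⊢ <;> omega

open HBFormula in
-- Only the two ends can be marked. With one end satisfying the premise and the other marked, `n ≤
-- N`, hence `n < N`, and `n + 1` zigzag steps still fall short.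
theorem apart_validIn {n : ℕ} (h : N ≠ n) : (apart n).ValidIn (Alg (N + 1)) := by
  intro v
  simp only [apart, eval_imp, eval_and, eval_iterate_box, eval_neg, eval_three, himp_eq_top_iff]
  set T := threeBelow (v 3) (v (3 + 1)) (v (3 + 2)) with hT
  have hTt : ∀ x ∈ (rep (N + 1)).carrier T, x = t 0 ∨ x = t (N + 1) :=
    fun x hx => eq_of_mem_threeBelow hx
  have hmem := (rep (N + 1)).mem_himp_bot T
  refine (rep _).le_of_forall fun x hx => ?_
  rw [(rep _).mem_inf] at hx
  obtain ⟨hx, hxn⟩ := hx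
  have hxT : x ∉ (rep (N + 1)).carrier T :=
    (hmem x).1 ((rep _).mem_iterate_biBox_of_le (Nat.zero_le n) hxn) x le_rfl
  rcases eq_of_mem_threeBelow hx with rfl | rfl
  · by_cases hN : t (N + 1) ∈ (rep (N + 1)).carrier T
    · have hn : n < N + 1 := by
        by_contra hn
        refine t_zero_notMem_iterate (V := T ⇨ ⊥) ?_
          ((rep _).mem_iterate_biBox_of_le (not_lt.1 hn) hxn)
        exact fun h => (hmem _).1 h _ (s_le_t.2 (Or.inr (by omega))) hN
      refine mem_iterate_of_hi (M := N + 1) (fun z hz => (hmem z).2 fun y hzy hy => ?_) _ _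
        (by simp only [hi]; omega)
      rcases hTt y hy with rfl | rfl
      · exact hxT hy
      · cases z <;> simp only [s_le_t, t_le_t, hi] at hzy hz <;> omega
    -- Here `T` is empty, and `M` only has to exceed `n + 1`.
    · refine mem_iterate_of_hi (M := n + 2) (fun z hz => (hmem z).2 fun y hzy hy => ?_) _ _
        (by simp only [hi]; omega)
      rcases hTt y hy with rfl | rfl
      · exact hxT hy
      · exact hN hy
  · by_cases h0 : t 0 ∈ (rep (N + 1)).carrier T
    · have hn : n < N + 1 := by
        by_contra hn
        refine t_last_notMem_iterate (V := T ⇨ ⊥) ?_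
          ((rep _).mem_iterate_biBox_of_le (not_lt.1 hn) hxn)
        exact fun h => (hmem _).1 h _ (s_le_t.2 (Or.inl (by omega))) h0
      refine mem_iterate_of_lo (M := 0) (fun z hz => (hmem z).2 fun y hzy hy => ?_) _ _
        (by simp only [lo]; omega)
      rcases hTt y hy with rfl | rfl
      · cases z <;> simp only [s_le_t, t_le_t, lo] at hzy hz <;> omega
      · exact hxT hy
    · refine mem_iterate_of_hi (M := N + n + 3) (fun z hz => (hmem z).2 fun y hzy hy => ?_) _ _
        (by simp only [hi]; omega)
      rcases hTt y hy with rfl | rfl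
      · exact h0 hy
      · exact hxT hy

/-- The complement of the minimal point `s j`. -/
def removeMin (N j : ℕ) : Alg N where
  carrier := {x | OrderDual.ofDual x ≠ s j}
  lower' := by
    rintro (j | i) (k | k) hle hx e
    · exact hx ((congrArg s (show j = k from hle)).trans e)
    · cases e
    · exact (show False from hle)
    · cases e

theorem mem_removeMin {j : ℕ} {x : Fence N} : x ∈ (rep N).carrier (removeMin N j) ↔ x ≠ s j :=
  Iff.rfl

theorem mem_threeBelow_removeMin {i j k : ℕ} (hij : i ≠ j) (hik : i ≠ k) (hjk : j ≠ k)
    {x : Fence N} :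
    x ∈ (rep N).carrier (threeBelow (removeMin N i) (removeMin N j) (removeMin N k)) ↔
      s i ≤ x ∧ s j ≤ x ∧ s k ≤ x := by
  have hbox : ∀ {i j : ℕ}, i ≠ j → x ∈ (rep N).carrier (biBox (removeMin N i ⊔ removeMin N j)) := by
    intro i j hij
    rw [(rep N).mem_biBox]
    intro y _ z _
    rw [(rep N).mem_sup, mem_removeMin, mem_removeMin]
    by_contra h
    rw [not_or, not_not, not_not] at h
    exact hij (s.inj (h.1.symm.trans h.2))
  simp only [threeBelow, (rep N).mem_inf, hbox hij, hbox hik, hbox hjk, (rep N).mem_top_sdiff,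
    mem_removeMin, and_true, not_not, exists_eq_right, and_assoc]

open HBFormula in
theorem not_apart_validIn (N : ℕ) : ¬ (apart N).ValidIn (Alg (N + 1)) := by
  intro h
  -- These three minimal points have only the far end `t (N + 1)` above all of them, while `s 0`, `s
  -- 1`, `s 2` mark `t 0`.
  let T : Alg (N + 1) := threeBelow (removeMin _ (N + 2)) (removeMin _ (N + 3)) (removeMin _ (N + 4))
  have hle : threeBelow (removeMin (N + 1) 0) (removeMin _ 1) (removeMin _ 2) ⊓
      biBox^[N] (T ⇨ ⊥) ≤ biBox^[N + 1] (T ⇨ ⊥) := by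
    have h' := h fun i => if i < 3 then removeMin _ i else removeMin _ (N + 2 + (i - 3))
    simp only [apart, eval_imp, eval_and, eval_iterate_box, eval_neg, eval_three,
      himp_eq_top_iff] at h'
    exact h'
  have hmemT : ∀ x, x ∈ (rep (N + 1)).carrier T ↔
      s (N + 2) ≤ x ∧ s (N + 3) ≤ x ∧ s (N + 4) ≤ x := fun x =>
    mem_threeBelow_removeMin (by omega) (by omega) (by omega)
  have hmem := (rep (N + 1)).mem_himp_bot T
  have h₀ : t 0 ∈ (rep (N + 1)).carrier (biBox^[N] (T ⇨ ⊥)) := by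
    refine mem_iterate_of_hi (M := N + 1) (fun z hz => (hmem z).2 fun y hzy hy => ?_) _ _
      (by simp only [hi]; omega)
    have hy' := ((hmemT y).1 hy).2.1
    cases y <;> cases z <;> simp only [s_le_s, s_le_t, t_le_t, not_t_le_s, hi] at hzy hy' hz <;>
      omega
  refine t_zero_notMem_iterate (V := T ⇨ ⊥) (fun h₁ => ?_) ((rep _).mem_of_le hle
    (((rep _).mem_inf _ _ _).2 ⟨(mem_threeBelow_removeMin (by omega) (by omega) (by omega)).2 ?_,
      h₀⟩))
  · refine (hmem _).1 h₁ (t (N + 1)) (s_le_t.2 (by omega)) ((hmemT _).2 ?_)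
    simp only [s_le_t]
    omega
  · simp only [s_le_t]
    omega

end Fence

/-! The continuum of logics between the Shehtman logic and the Fine logic. -/

namespace HBFormula

/-- A numbering of formulas. -/
def code : HBFormula → ℕ
  | var n => Nat.pair 0 n
  | bot => Nat.pair 1 0
  | and φ ψ => Nat.pair 2 (Nat.pair φ.code ψ.code)
  | or φ ψ => Nat.pair 3 (Nat.pair φ.code ψ.code)
  | imp φ ψ => Nat.pair 4 (Nat.pair φ.code ψ.code)
  | coimp φ ψ => Nat.pair 5 (Nat.pair φ.code ψ.code)

theorem code_injective : Function.Injective code := by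
  intro φ
  induction φ with
  | var n => intro ψ h; cases ψ <;> simp_all [code, Nat.pair_eq_pair]
  | bot => intro ψ h; cases ψ <;> simp_all [code, Nat.pair_eq_pair]
  | and φ₁ φ₂ ih₁ ih₂ =>
    intro ψ h
    cases ψ <;> simp only [code, Nat.pair_eq_pair, reduceCtorEq,
      Nat.reduceEqDiff, false_and, true_and] at h
    rw [ih₁ h.1, ih₂ h.2]
  | or φ₁ φ₂ ih₁ ih₂ =>
    intro ψ h
    cases ψ <;> simp only [code, Nat.pair_eq_pair, reduceCtorEq,
      Nat.reduceEqDiff, false_and, true_and] at h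
    rw [ih₁ h.1, ih₂ h.2]
  | imp φ₁ φ₂ ih₁ ih₂ =>
    intro ψ h
    cases ψ <;> simp only [code, Nat.pair_eq_pair, reduceCtorEq,
      Nat.reduceEqDiff, false_and, true_and] at h
    rw [ih₁ h.1, ih₂ h.2]
  | coimp φ₁ φ₂ ih₁ ih₂ =>
    intro ψ h
    cases ψ <;> simp only [code, Nat.pair_eq_pair, reduceCtorEq,
      Nat.reduceEqDiff, false_and, true_and] at h
    rw [ih₁ h.1, ih₂ h.2]

instance : Countable HBFormula := code_injective.countable

end HBFormula

theorem mk_set_HBFormula_le : Cardinal.mk (Set HBFormula) ≤ Cardinal.continuum := by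
  rw [Cardinal.mk_set, ← Cardinal.two_power_aleph0]
  exact Cardinal.power_le_power_left two_ne_zero Cardinal.mk_le_aleph0

/-- The intersection of the Fine logic with the logics of the fences of length `i + 1`, `i ∈ S`. -/
def fineFenceLogic (S : Set ℕ) : Set HBFormula :=
  ⋂₀ insert FineLogic ((fun i => {φ | φ.ValidIn (Fence.Alg (i + 2))}) '' S)

theorem isIntermediateHBLogic_fineFenceLogic (S : Set ℕ) :
    IsIntermediateHBLogic (fineFenceLogic S) := by
  have hbot : ∀ {A : Type} [BiheytingAlgebra A] {X : Type} [PartialOrder X],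
      UpsetRep A X → X → Nontrivial A := fun R x =>
    ⟨⊥, ⊤, fun h => R.mem_bot x (h ▸ R.mem_top x)⟩
  refine IsIntermediateHBLogic.sInter (Set.insert_nonempty _ _) ?_
  rintro L (rfl | ⟨i, -, rfl⟩)
  · have := hbot FineAlgebra.rep FineSpace.infty
    exact isIntermediateHBLogic_validIn FineAlgebra
  · have := hbot (Fence.rep (i + 2)) (.t 0)
    exact isIntermediateHBLogic_validIn (Fence.Alg (i + 2))

theorem shehtmanLogic_subset_fineFenceLogic (S : Set ℕ) : ShehtmanLogic ⊆ fineFenceLogic S := by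
  refine Set.subset_sInter ?_
  rintro L (rfl | ⟨i, -, rfl⟩)
  · exact validatesShehtman_iff.1 FineAlgebra.validatesShehtman
  · exact validatesShehtman_iff.1 (Fence.validatesShehtman (i + 2))

theorem fineFenceLogic_subset (S : Set ℕ) : fineFenceLogic S ⊆ FineLogic :=
  Set.sInter_subset_of_mem (Set.mem_insert _ _)

/-- The shift by one keeps `apart 0` out, as the rooted-frame argument needs a positive index. -/
theorem apart_mem_fineFenceLogic_iff (S : Set ℕ) (i : ℕ) :
    HBFormula.apart (i + 1) ∈ fineFenceLogic S ↔ i ∉ S := by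
  constructor
  · exact fun h hi => Fence.not_apart_validIn (i + 1) (h _ (Or.inr ⟨i, hi, rfl⟩))
  · rintro hi L (rfl | ⟨j, hj, rfl⟩)
    · exact FineAlgebra.rep.apart_validIn_of_root FineSpace.root_le i
    · refine Fence.apart_validIn fun h => hi ?_
      obtain rfl : j = i := by omega
      exact hj

theorem fineFenceLogic_injective : Function.Injective fineFenceLogic := by
  intro S T h
  ext i
  rw [← not_iff_not, ← apart_mem_fineFenceLogic_iff, h, apart_mem_fineFenceLogic_iff]

theorem mainTheorem4 :
    Cardinal.mk {L : Set HBFormula // IsIntermediateHBLogic L ∧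
        ¬ IsTopologicallyComplete.{u} L} = Cardinal.continuum ∧
    Cardinal.mk {L : Set HBFormula // IsIntermediateHBLogic L ∧
        ShehtmanLogic ⊆ L ∧ L ⊆ FineLogic ∧
        ¬ IsTopologicallyComplete.{u} L} = Cardinal.continuum := by
  have lower : Cardinal.continuum ≤ Cardinal.mk {L : Set HBFormula // IsIntermediateHBLogic L ∧
      ShehtmanLogic ⊆ L ∧ L ⊆ FineLogic ∧ ¬ IsTopologicallyComplete.{u} L} := by
    rw [← Cardinal.mk_set_nat]
    refine Cardinal.mk_le_of_injective (f := fun S => ⟨fineFenceLogic S,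
      isIntermediateHBLogic_fineFenceLogic S, shehtmanLogic_subset_fineFenceLogic S,
      fineFenceLogic_subset S, not_isTopologicallyComplete (shehtmanLogic_subset_fineFenceLogic S)
        fun h => FineAlgebra.delta_zero_not_mem (fineFenceLogic_subset S h)⟩) ?_
    exact fun S T h => fineFenceLogic_injective (congrArg Subtype.val h)
  refine ⟨le_antisymm ((Cardinal.mk_subtype_le _).trans mk_set_HBFormula_le) (lower.trans ?_),
    le_antisymm ((Cardinal.mk_subtype_le _).trans mk_set_HBFormula_le) lower⟩
  exact Cardinal.mk_subtype_mono fun L h => ⟨h.1, h.2.2.2⟩
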